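/- Let $X=(X_t)_{t\ge 0}$ be a real-valued Lévy process (issued from $0$, with independent and stationary increments and almost surely càdlàg paths) on a probability space, with zero mean and finite variance, i.e. $\mathbb E[X_t]=0$ and $\mathbb E[X_t^2]<\infty$ for all $t\ge 0$, and not degenerate, i.e. $\operatorname{Var}(X_1)>0$. Write $\underline X_t:=\inf_{0\le s\le t}X_s$ and $x\wedge y:=\min\{x,y\}$. (1) Let $C_0>0$ be arbitrary. Then $C_0$ is a concentration constant for $X$: there is $c>0$ such that $$\sup_{r\in\mathbb R}\mathbb P\big(r\le X_t\le r+h\big)\le c\,\frac{h}{t^{1/2}}\qquad\text{for all } h\ge C_0 \text{ and } t>0 .$$ Moreover, there is $c>0$ (depending only on $X$ and $C_0$) such that for every $f:[0,\infty)\to[0,\infty)$ bounded away from $0$, every $g:[0,\infty)\to\mathbb R$ with $g(t)\ge -f(t)$ for all $t\ge 0$, and every $t>0$, $$\mathbb P\Big(g(t)\le X_t\le g(t)+C_0,\ \underline X_t\ge -f(t)\Big)\le c\,\frac{\{(f(t)+1)\wedge t^{1/2}\}\,\{(g(t)+f(t)+1)\wedge t^{1/2}\}}{t^{3/2}} .$$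 (2) There is $c'>0$ (depending only on $X$) such that for all such $f$ and $g$ and every $t>0$, $$\mathbb P\Big(X_t\le g(t),\ \underline X_t\ge -f(t)\Big)\le c'\,\frac{\{(f(t)+1)\wedge t^{1/2}\}\,\{(g(t)+f(t)+1)^2\wedge t\}}{t^{3/2}} .$$ -/

import Mathlib

open MeasureTheory ProbabilityTheory Filter Topology
open scoped NNReal

/-- A real-valued Lévy process `X = (X_t)_{t ≥ 0}` on `(Ω, P)`: it is issued from `0`, has
independent and stationary increments, and almost surely its path is càdlàg, that is,
right-continuous with (finite) left limits. -/
structure IsLevyProcess {Ω : Type*} [MeasurableSpace Ω] (X : ℝ≥0 → Ω → ℝ) (P : Measure Ω) :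
    Prop where
  measurable : ∀ t, Measurable (X t)
  zero : ∀ᵐ ω ∂P, X 0 ω = 0
  indepIncrements : HasIndepIncrements X P
  stationaryIncrements : ∀ s t : ℝ≥0, IdentDistrib (X (s + t) - X s) (X t) P P
  cadlag : ∀ᵐ ω ∂P, ∀ t : ℝ≥0,
    ContinuousWithinAt (fun s ↦ X s ω) (Set.Ici t) t ∧
      ∃ l : ℝ, Tendsto (fun s ↦ X s ω) (𝓝[<] t) (𝓝 l)

/-- The running infimum `inf_{0 ≤ s ≤ t} X_s`. A càdlàg path is bounded on `[0, t]`, so on almost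
every path of a Lévy process this is a genuine infimum of a nonempty bounded set. -/
noncomputable def runningInf {Ω : Type*} (X : ℝ≥0 → Ω → ℝ) (t : ℝ≥0) (ω : Ω) : ℝ :=
  ⨅ s : Set.Icc (0 : ℝ≥0) t, X s ω

/-! For the local bound in (1), cut `[0, t]` into three pieces of comparable length. On the first
piece the path has to stay above `-f`, which costs `(f + 1) / √t`. Seen backwards from its endpoint,
the last piece is a path of the dual process `-X`, which has to stay above `-(g + f + C₀)`; this
costs `(g + f + 1) / √t`. The middle increment is independent of both and has to fall into a window
of length `C₀` whose position they determine; concentration prices this at `1 / √t`. The product is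
the claim. On the outer pieces the barrier is checked at unit time steps only, which enlarges the
event and reduces it to random walks (`measureReal_three_parts_le`).

Concentration is Esseen's inequality: the characteristic function of `X 1` has Gaussian decay near
the origin, and that of `X t` is dominated by its `⌊t⌋`-th power.

The survival estimate `exists_measureReal_forall_le_walk_le` avoids fluctuation identities. By time
reversal, surviving above `-x` up to time `n` is as likely as being within `x` of the running
maximum `M` at time `n`. From there, a block of `m ≍ (x + 1)²` further steps raises the maximum by
at least `x + 1` on average, because `E|S_m| ≥ b √m` (a consequence of concentration). Summing `E
M_{n+m} - E M_n` over `n < N` telescopes to at most `m E M_{N+m}`, of order `m √(N + m)` by Doob.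
Since survival probabilities decrease in `n`, `N (x + 1) F(N) ≲ (x + 1)² √N`, where `F(N)` is the
survival probability; for `N < m` the bound is trivial.

For (2), either forget the endpoint and use survival alone, or sum (1) over unit windows covering
`[-f, g]`. -/

/-! ### Characteristic functions and Esseen's inequality -/

/-- A centred nondegenerate square integrable law has a characteristic function with Gaussian
decay near the origin. -/
lemma exists_norm_charFun_map_le_exp {Ω : Type*} [MeasurableSpace Ω] {P : Measure Ω}
    [IsProbabilityMeasure P] {Y : Ω → ℝ} (hY : MemLp Y 2 P) (hmean : ∫ ω, Y ω ∂P = 0)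
    (hvar : 0 < Var[Y; P]) :
    ∃ b : ℝ, 0 < b ∧ ∃ δ : ℝ, 0 < δ ∧ ∀ u : ℝ, |u| ≤ δ →
      ‖charFun (P.map Y) u‖ ≤ Real.exp (-b * u ^ 2) := by
  set s := √Var[Y; P] with hs
  have hs0 : 0 < s := Real.sqrt_pos.2 hvar
  have hs2 : s ^ 2 = Var[Y; P] := Real.sq_sqrt hvar.le
  have hYm : AEMeasurable Y P := hY.aestronglyMeasurable.aemeasurable
  have hsq : ∫ ω, Y ω ^ 2 ∂P = s ^ 2 := by
    rw [hs2, variance_of_integral_eq_zero hYm hmean]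
  have h0 : P[fun ω ↦ s⁻¹ * Y ω] = 0 := by
    rw [integral_const_mul, hmean, mul_zero]
  have h1 : P[(fun ω ↦ s⁻¹ * Y ω) ^ 2] = 1 := by
    simp only [Pi.pow_apply, mul_pow]
    rw [integral_const_mul, hsq]
    field_simp
  have hT := taylor_charFun_two (hYm.const_mul s⁻¹) h0 h1
  -- An error of a quarter of the square leaves `1 - v² / 4` out of `1 - v² / 2`, where `v = s * u`;
  -- hence the rate `s ^ 2 / 4`.
  have hE := hT.def (c := 1 / 4) (by norm_num)
  obtain ⟨ε, hε, hball⟩ := Metric.eventually_nhds_iff.1 hE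
  set δ' := min (ε / 2) 1 with hδ'
  have hδ'0 : 0 < δ' := by positivity
  refine ⟨s ^ 2 / 4, by positivity, δ' / s, by positivity, fun u hu ↦ ?_⟩
  have hus : |s * u| ≤ δ' := by
    rw [abs_mul, abs_of_pos hs0]
    rwa [le_div_iff₀ hs0, mul_comm] at hu
  have h2 := hball (y := s * u) (by
    rw [dist_zero_right, Real.norm_eq_abs]
    exact hus.trans_lt ((min_le_left _ _).trans_lt (by linarith)))
  have hchar : charFun (P.map fun ω ↦ s⁻¹ * Y ω) (s * u) = charFun (P.map Y) u := by
    rw [charFun_map_mul_comp hYm]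
    congr 1
    field_simp
  rw [hchar] at h2
  have hsu : (s * u) ^ 2 ≤ 1 := by
    rw [← sq_abs]
    exact pow_le_one₀ (abs_nonneg _) (hus.trans (min_le_right _ _))
  have h3 : ‖(1 - ((s * u : ℝ) : ℂ) ^ 2 / 2)‖ = 1 - (s * u) ^ 2 / 2 := by
    have : (1 - ((s * u : ℝ) : ℂ) ^ 2 / 2) = ((1 - (s * u) ^ 2 / 2 : ℝ) : ℂ) := by push_cast; ring
    rw [this, Complex.norm_real, Real.norm_eq_abs, abs_of_nonneg (by linarith)]
  have h4 : ‖charFun (P.map Y) u‖ ≤ 1 - (s * u) ^ 2 / 2 + 1 / 4 * (s * u) ^ 2 := by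
    rw [← h3]
    calc _ ≤ ‖(1 - ((s * u : ℝ) : ℂ) ^ 2 / 2)‖ +
          ‖charFun (P.map Y) u - (1 - ((s * u : ℝ) : ℂ) ^ 2 / 2)‖ := by
          have := norm_add_le (1 - ((s * u : ℝ) : ℂ) ^ 2 / 2)
            (charFun (P.map Y) u - (1 - ((s * u : ℝ) : ℂ) ^ 2 / 2))
          rwa [add_sub_cancel] at this
      _ ≤ _ := by
          gcongr
          rwa [norm_pow, Real.norm_eq_abs, sq_abs] at h2
  have h5 := Real.add_one_le_exp (-(s ^ 2 / 4) * u ^ 2)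
  nlinarith [h4, h5]

/-- Esseen's inequality for a characteristic function with Gaussian decay near the origin. -/
lemma measureReal_Icc_le_of_norm_charFun_le_exp {μ : Measure ℝ} [IsProbabilityMeasure μ]
    {δ b : ℝ} (hδ : 0 < δ) (hb : 0 < b)
    (hμ : ∀ u : ℝ, |u| ≤ δ → ‖charFun μ u‖ ≤ Real.exp (-b * u ^ 2)) (a : ℝ) :
    μ.real (Set.Icc (a - 1 / δ) (a + 1 / δ)) ≤ √(Real.pi / b) / (δ * Real.cos 1 ^ 2) := by
  set κ : Measure ℝ := volume.restrict (Set.Ioc 0 δ) with hκ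
  have hκu : κ.real Set.univ = δ := by simp [hκ, Measure.real, hδ.le]
  have hcos1 : 0 < Real.cos 1 := Real.cos_one_pos
  -- the kernel
  set K : ℝ → ℝ := fun z ↦ ∫ p : ℝ × ℝ, Real.cos ((p.1 - p.2) * (z - a)) ∂(κ.prod κ) with hK
  have hbd (f : ℝ × ℝ → ℝ) (hf : Continuous f) (hf1 : ∀ p, |f p| ≤ 1) :
      Integrable f (κ.prod κ) :=
    Integrable.of_bound hf.aestronglyMeasurable 1 (ae_of_all _ hf1)
  -- `K z` is the squared modulus of `∫ exp (i u (z - a))` over `(0, δ]`: nonnegative everywhere,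
  -- and of size `δ²` where `|z - a| ≤ 1 / δ`.
  have hKeq (z : ℝ) : K z = (∫ u, Real.cos (u * (z - a)) ∂κ) ^ 2 +
      (∫ u, Real.sin (u * (z - a)) ∂κ) ^ 2 := by
    have : ∀ p : ℝ × ℝ, Real.cos ((p.1 - p.2) * (z - a)) =
        Real.cos (p.1 * (z - a)) * Real.cos (p.2 * (z - a)) +
        Real.sin (p.1 * (z - a)) * Real.sin (p.2 * (z - a)) := fun p ↦ by
      rw [sub_mul, Real.cos_sub]
    simp only [hK, this]
    rw [integral_add,
      integral_prod_mul (fun u ↦ Real.cos (u * (z - a))) (fun u ↦ Real.cos (u * (z - a))),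
      integral_prod_mul (fun u ↦ Real.sin (u * (z - a))) (fun u ↦ Real.sin (u * (z - a)))]
    · ring
    · refine hbd _ (by fun_prop) fun p ↦ ?_
      rw [abs_mul]
      exact mul_le_one₀ (Real.abs_cos_le_one _) (abs_nonneg _) (Real.abs_cos_le_one _)
    · refine hbd _ (by fun_prop) fun p ↦ ?_
      rw [abs_mul]
      exact mul_le_one₀ (Real.abs_sin_le_one _) (abs_nonneg _) (Real.abs_sin_le_one _)
  have hKlow (z : ℝ) (hz : z ∈ Set.Icc (a - 1 / δ) (a + 1 / δ)) : (δ * Real.cos 1) ^ 2 ≤ K z := by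
    rw [hKeq]
    have hz' : |z - a| ≤ 1 / δ := by
      rw [abs_le]; constructor <;> linarith [hz.1, hz.2]
    have : δ * Real.cos 1 ≤ ∫ u, Real.cos (u * (z - a)) ∂κ := by
      have h1 : ∫ _u, Real.cos 1 ∂κ = δ * Real.cos 1 := by
        rw [integral_const, hκu, smul_eq_mul]
      rw [← h1]
      refine integral_mono_ae (integrable_const _) ?_ ?_
      · exact Integrable.of_bound (by fun_prop) 1 (ae_of_all _ fun u ↦ Real.abs_cos_le_one _)
      · filter_upwards [ae_restrict_mem measurableSet_Ioc] with u hu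
        rw [← Real.cos_abs (u * (z - a))]
        refine Real.cos_le_cos_of_nonneg_of_le_pi (abs_nonneg _) (by linarith [Real.pi_gt_three]) ?_
        rw [abs_mul, abs_of_pos hu.1]
        calc u * |z - a| ≤ δ * (1 / δ) := by gcongr; exact hu.2
          _ = 1 := by field_simp
    have h0 : 0 ≤ δ * Real.cos 1 := by positivity
    nlinarith [sq_nonneg (∫ u, Real.sin (u * (z - a)) ∂κ), pow_le_pow_left₀ h0 this 2]
  have hint : Integrable (fun q : ℝ × (ℝ × ℝ) ↦ Real.cos ((q.2.1 - q.2.2) * (q.1 - a)))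
      (μ.prod (κ.prod κ)) :=
    Integrable.of_bound (Continuous.aestronglyMeasurable (by fun_prop)) 1
      (ae_of_all _ fun p ↦ Real.abs_cos_le_one _)
  have hKint : Integrable K μ := hint.integral_prod_left
  have hKnn (z : ℝ) : 0 ≤ K z := by rw [hKeq]; positivity
  -- lower bound
  have hlow : (δ * Real.cos 1) ^ 2 * μ.real (Set.Icc (a - 1 / δ) (a + 1 / δ)) ≤ ∫ z, K z ∂μ := by
    calc _ = ∫ z in Set.Icc (a - 1 / δ) (a + 1 / δ), (δ * Real.cos 1) ^ 2 ∂μ := by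
          rw [setIntegral_const, smul_eq_mul, mul_comm]
      _ ≤ ∫ z in Set.Icc (a - 1 / δ) (a + 1 / δ), K z ∂μ :=
          setIntegral_mono_on (integrable_const _).integrableOn hKint.integrableOn
            measurableSet_Icc hKlow
      _ ≤ _ := setIntegral_le_integral hKint (ae_of_all _ hKnn)
  -- upper bound
  have hchar (w : ℝ) : ∫ z, Real.cos (w * (z - a)) ∂μ ≤ ‖charFun μ w‖ := by
    have hI : Integrable (fun z : ℝ ↦ Complex.exp (w * (z - a) * Complex.I)) μ := by
      refine Integrable.of_bound (Continuous.aestronglyMeasurable (by fun_prop)) 1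
        (ae_of_all _ fun z ↦ ?_)
      have := Complex.norm_exp_ofReal_mul_I (w * (z - a))
      push_cast at this
      rw [this]
    have h1 : ∫ z, Real.cos (w * (z - a)) ∂μ =
        (∫ z : ℝ, Complex.exp (w * (z - a) * Complex.I) ∂μ).re := by
      have := integral_re hI
      simp only [RCLike.re_to_complex] at this
      rw [← this]
      congr with z
      have := Complex.exp_ofReal_mul_I_re (w * (z - a))
      push_cast at this
      rw [this]
    have h2 : ∫ z : ℝ, Complex.exp (w * (z - a) * Complex.I) ∂μ =
        Complex.exp ((-(w * a) : ℝ) * Complex.I) * charFun μ w := by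
      rw [charFun_apply_real, ← integral_const_mul]
      congr with z
      rw [← Complex.exp_add]
      congr 1
      push_cast
      ring
    rw [h1]
    refine (Complex.re_le_norm _).trans ?_
    rw [h2, norm_mul, Complex.norm_exp_ofReal_mul_I, one_mul]
  -- With one frequency frozen, the other integrates to at most a full shifted Gaussian; the frozen
  -- one then contributes the factor `δ`.
  have hgauss (v : ℝ) : ∫ u, Real.exp (-b * (u - v) ^ 2) = √(Real.pi / b) := by
    rw [integral_sub_right_eq_self (fun u ↦ Real.exp (-b * u ^ 2)) v, integral_gaussian]
  have hgint (v : ℝ) : Integrable (fun u ↦ Real.exp (-b * (u - v) ^ 2)) :=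
    (integrable_exp_neg_mul_sq hb).comp_sub_right v
  have hexpint : Integrable (fun p : ℝ × ℝ ↦ Real.exp (-b * (p.1 - p.2) ^ 2)) (κ.prod κ) := by
    refine hbd _ (by fun_prop) fun p ↦ ?_
    rw [Real.abs_exp, Real.exp_le_one_iff]
    nlinarith [sq_nonneg (p.1 - p.2)]
  have hup : ∫ z, K z ∂μ ≤ δ * √(Real.pi / b) := by
    calc ∫ z, K z ∂μ = ∫ p : ℝ × ℝ, ∫ z, Real.cos ((p.1 - p.2) * (z - a)) ∂μ ∂(κ.prod κ) :=
          integral_integral_swap hint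
      _ ≤ ∫ p : ℝ × ℝ, Real.exp (-b * (p.1 - p.2) ^ 2) ∂(κ.prod κ) := by
          refine integral_mono_ae hint.integral_prod_right hexpint ?_
          have : ∀ᵐ p ∂(κ.prod κ), p ∈ Set.Ioc 0 δ ×ˢ Set.Ioc 0 δ := by
            rw [hκ, Measure.prod_restrict]
            exact ae_restrict_mem (measurableSet_Ioc.prod measurableSet_Ioc)
          filter_upwards [this] with p hp
          refine (hchar _).trans (hμ _ ?_)
          rw [abs_le]
          constructor <;> linarith [hp.1.1, hp.1.2, hp.2.1, hp.2.2]
      _ = ∫ v, ∫ u, Real.exp (-b * (u - v) ^ 2) ∂κ ∂κ := integral_prod_symm _ hexpint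
      _ ≤ ∫ _v, √(Real.pi / b) ∂κ := by
          refine integral_mono hexpint.integral_prod_right (integrable_const _) fun v ↦ ?_
          rw [← hgauss v]
          exact setIntegral_le_integral (hgint v) (ae_of_all _ fun u ↦ (Real.exp_pos _).le)
      _ = _ := by rw [integral_const, hκu, smul_eq_mul]
  rw [le_div_iff₀ (by positivity)]
  have h := hlow.trans hup
  have : δ * (μ.real (Set.Icc (a - 1 / δ) (a + 1 / δ)) * (δ * Real.cos 1 ^ 2)) ≤
      δ * √(Real.pi / b) := by
    calc _ = (δ * Real.cos 1) ^ 2 * μ.real (Set.Icc (a - 1 / δ) (a + 1 / δ)) := by ring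
      _ ≤ _ := h
  exact le_of_mul_le_mul_left this hδ

/-! ### Concentration of Lévy processes at scale `√t` -/

section Levy

variable {Ω : Type*} [MeasurableSpace Ω] {P : Measure Ω} {X : ℝ≥0 → Ω → ℝ}

lemma IsLevyProcess.neg (hX : IsLevyProcess X P) : IsLevyProcess (-X) P where
  measurable t := (hX.measurable t).neg
  zero := by filter_upwards [hX.zero] with ω hω using by simp [hω]
  indepIncrements := hX.indepIncrements.neg
  stationaryIncrements s t := by
    have := (hX.stationaryIncrements s t).comp measurable_neg
    convert this using 1
    · ext ω
      simp [neg_add_eq_sub]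
    · rfl
  cadlag := by
    filter_upwards [hX.cadlag] with ω hω t
    obtain ⟨h1, l, h2⟩ := hω t
    exact ⟨h1.neg, -l, h2.neg⟩

variable [IsProbabilityMeasure P]

/-- Independent unit increments are peeled off the end, each giving one factor; the initial stretch
of length `s` is only bounded by `1`. -/
lemma IsLevyProcess.norm_charFun_map_le (hX : IsLevyProcess X P) (u : ℝ) (n : ℕ) (s : ℝ≥0) :
    ‖charFun (P.map (X (s + n))) u‖ ≤ ‖charFun (P.map (X 1)) u‖ ^ n := by
  have hprob (t : ℝ≥0) : IsProbabilityMeasure (P.map (X t)) :=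
    Measure.isProbabilityMeasure_map (hX.measurable t).aemeasurable
  induction n with
  | zero => simpa using norm_charFun_le_one u
  | succ n ih =>
    have hind : X (s + n) ⟂ᵢ[P] (X (s + n + 1) - X (s + n)) :=
      hX.indepIncrements.indepFun_eval_sub zero_le le_self_add hX.zero
    have h := hind.charFun_map_add_eq_mul (hX.measurable _).aemeasurable
      ((hX.measurable _).sub (hX.measurable _)).aemeasurable
    rw [add_sub_cancel, (hX.stationaryIncrements (s + n) 1).map_eq] at h
    have h' : charFun (P.map (X (s + (n + 1 : ℕ)))) u =
        charFun (P.map (X (s + n))) u * charFun (P.map (X 1)) u := by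
      push_cast
      rw [← add_assoc, h, Pi.mul_apply]
    rw [h', norm_mul, pow_succ]
    gcongr

/-- A concentration bound on one scale transfers to all larger scales by covering. -/
lemma measureReal_Icc_le_of_le {Y : Ω → ℝ} {ℓ q : ℝ} (hℓ : 0 < ℓ)
    (hq : ∀ r, P.real {ω | r ≤ Y ω ∧ Y ω ≤ r + ℓ} ≤ q) {h : ℝ} (hh : 0 ≤ h) (r : ℝ) :
    P.real {ω | r ≤ Y ω ∧ Y ω ≤ r + h} ≤ (h / ℓ + 1) * q := by
  have hq0 : 0 ≤ q := measureReal_nonneg.trans (hq 0)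
  have hsub : {ω | r ≤ Y ω ∧ Y ω ≤ r + h} ⊆
      ⋃ k ∈ Finset.range (⌊h / ℓ⌋₊ + 1),
        {ω | r + k * ℓ ≤ Y ω ∧ Y ω ≤ r + k * ℓ + ℓ} := by
    intro ω hω
    have h0 : 0 ≤ (Y ω - r) / ℓ := div_nonneg (sub_nonneg.2 hω.1) hℓ.le
    have h1 := Nat.floor_le h0
    have h2 := (Nat.lt_floor_add_one ((Y ω - r) / ℓ)).le
    rw [le_div_iff₀ hℓ] at h1
    rw [div_le_iff₀ hℓ] at h2
    simp only [Set.mem_iUnion, Finset.mem_range, Set.mem_ofPred_eq, exists_prop]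
    refine ⟨⌊(Y ω - r) / ℓ⌋₊, Nat.lt_succ_of_le (Nat.floor_le_floor ?_), by linarith, by linarith⟩
    gcongr
    linarith [hω.2]
  calc P.real {ω | r ≤ Y ω ∧ Y ω ≤ r + h}
      ≤ P.real (⋃ k ∈ Finset.range (⌊h / ℓ⌋₊ + 1),
        {ω | r + k * ℓ ≤ Y ω ∧ Y ω ≤ r + k * ℓ + ℓ}) := measureReal_mono hsub (measure_ne_top _ _)
    _ ≤ ∑ k ∈ Finset.range (⌊h / ℓ⌋₊ + 1),
        P.real {ω | r + k * ℓ ≤ Y ω ∧ Y ω ≤ r + k * ℓ + ℓ} := measureReal_biUnion_finset_le _ _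
    _ ≤ ∑ _k ∈ Finset.range (⌊h / ℓ⌋₊ + 1), q := Finset.sum_le_sum fun k _ ↦ hq _
    _ = (⌊h / ℓ⌋₊ + 1 : ℝ) * q := by simp
    _ ≤ _ := by gcongr; exact Nat.floor_le (by positivity)

/-- Every positive number is a concentration constant. -/
lemma IsLevyProcess.exists_concentration (hX : IsLevyProcess X P) (hvar : MemLp (X 1) 2 P)
    (hmean : ∫ ω, X 1 ω ∂P = 0) (hnondeg : 0 < Var[X 1; P]) {C₀ : ℝ} (hC₀ : 0 < C₀) :
    ∃ c : ℝ, 0 < c ∧ ∀ h : ℝ, C₀ ≤ h → ∀ t : ℝ≥0, 0 < t → ∀ r : ℝ,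
      P.real {ω | r ≤ X t ω ∧ X t ω ≤ r + h} ≤ c * (h / √(t : ℝ)) := by
  obtain ⟨b, hb, δ, hδ, hchar⟩ := exists_norm_charFun_map_le_exp hvar hmean hnondeg
  have hcos1 : 0 < Real.cos 1 := Real.cos_one_pos
  set A : ℝ := √(2 * Real.pi / b) / (δ * Real.cos 1 ^ 2) with hA
  have hA0 : 0 < A := by have := Real.pi_pos; positivity
  have hlarge (t : ℝ≥0) (ht : 1 ≤ t) (r : ℝ) :
      P.real {ω | r ≤ X t ω ∧ X t ω ≤ r + 2 / δ} ≤ A / √(t : ℝ) := by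
    have ht1 : (1 : ℝ) ≤ t := by exact_mod_cast ht
    set n := ⌊t⌋₊ with hn
    have hnt : (n : ℝ≥0) ≤ t := Nat.floor_le zero_le
    have hn1 : 1 ≤ n := Nat.one_le_floor_iff _ |>.2 ht
    have htn : (t : ℝ) ≤ 2 * n := by
      have h1 : t < n + 1 := Nat.lt_floor_add_one t
      have h2 : (t : ℝ) < n + 1 := by exact_mod_cast h1
      have h3 : (1 : ℝ) ≤ n := by exact_mod_cast hn1
      linarith
    have hn0 : (0 : ℝ) < n := by exact_mod_cast hn1
    have : IsProbabilityMeasure (P.map (X t)) :=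
      Measure.isProbabilityMeasure_map (hX.measurable t).aemeasurable
    have h1 := measureReal_Icc_le_of_norm_charFun_le_exp (μ := P.map (X t)) hδ
      (b := n * b) (by positivity) (fun u hu ↦ by
        have := hX.norm_charFun_map_le u n (t - n)
        rw [tsub_add_cancel_of_le hnt] at this
        refine this.trans ((pow_le_pow_left₀ (norm_nonneg _) (hchar u hu) n).trans_eq ?_)
        rw [← Real.exp_nat_mul]
        congr 1
        ring) (r + 1 / δ)
    rw [map_measureReal_apply (hX.measurable t) measurableSet_Icc] at h1
    have hset : {ω | r ≤ X t ω ∧ X t ω ≤ r + 2 / δ} =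
        X t ⁻¹' Set.Icc (r + 1 / δ - 1 / δ) (r + 1 / δ + 1 / δ) := by
      ext ω
      simp only [Set.mem_ofPred_eq, Set.mem_preimage, Set.mem_Icc]
      rw [add_sub_cancel_right, add_assoc, ← add_div, one_add_one_eq_two]
    rw [hset]
    refine h1.trans ?_
    rw [hA, div_right_comm, ← Real.sqrt_div (by have := Real.pi_pos; positivity)]
    gcongr ?_ / _
    refine Real.sqrt_le_sqrt ?_
    rw [div_div, div_le_div_iff₀ (by positivity) (by positivity)]
    nlinarith [mul_le_mul_of_nonneg_left htn (mul_pos Real.pi_pos hb).le]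
  have hδ2 : 0 < 2 / δ := by positivity
  -- The first summand comes from covering by intervals of length `2 / δ` when `t ≥ 1`; the last one
  -- makes the bound exceed `1` when `t ≤ 1`.
  refine ⟨(1 / (2 / δ) + 1 / C₀) * A + 1 / C₀, by positivity, fun h hh t ht r ↦ ?_⟩
  have hh0 : 0 < h := hC₀.trans_le hh
  have ht0 : (0 : ℝ) < t := by exact_mod_cast ht
  have hst : 0 < √(t : ℝ) := Real.sqrt_pos.2 ht0
  have h1C : 1 ≤ h / C₀ := (one_le_div hC₀).2 hh
  rcases le_total 1 t with h1 | h1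
  · refine (measureReal_Icc_le_of_le hδ2 (hlarge t h1) hh0.le r).trans ?_
    calc (h / (2 / δ) + 1) * (A / √(t : ℝ)) ≤ (h / (2 / δ) + h / C₀) * (A / √(t : ℝ)) := by gcongr
      _ = (1 / (2 / δ) + 1 / C₀) * A * (h / √(t : ℝ)) := by ring
      _ ≤ _ := by gcongr; linarith [one_div_pos.2 hC₀]
  · have hs1 : √(t : ℝ) ≤ 1 := Real.sqrt_le_one.2 (by exact_mod_cast h1)
    calc _ ≤ (1 : ℝ) := measureReal_le_one
      _ ≤ h / C₀ / √(t : ℝ) := (one_le_div hst).2 (hs1.trans h1C)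
      _ = 1 / C₀ * (h / √(t : ℝ)) := by ring
      _ ≤ _ := by
        gcongr
        have : 0 ≤ (1 / (2 / δ) + 1 / C₀) * A := by positivity
        linarith

/-- The first absolute moment of a centred square integrable Lévy process grows like the square
root of time. -/
lemma IsLevyProcess.exists_le_integral_abs (hX : IsLevyProcess X P)
    (hvar : ∀ t : ℝ≥0, MemLp (X t) 2 P)
    (hmean : ∫ ω, X 1 ω ∂P = 0) (hnondeg : 0 < Var[X 1; P]) :
    ∃ b : ℝ, 0 < b ∧ ∃ m₀ : ℕ, ∀ m : ℕ, m₀ ≤ m → b * √(m : ℝ) ≤ ∫ ω, |X m ω| ∂P := by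
  obtain ⟨c, hc, hconc⟩ := hX.exists_concentration (hvar 1) hmean hnondeg one_pos
  -- With `h = √m / (4 c)`, the ball of radius `h` has mass at most `1 / 2`, so Markov's inequality
  -- gives `h / 2`. The threshold on `m` ensures `2 h ≥ 1`, the scale from which concentration
  -- holds.
  refine ⟨1 / (8 * c), by positivity, ⌈4 * c ^ 2⌉₊ + 1, fun m hm ↦ ?_⟩
  have hm1 : 0 < m := by omega
  have hm0 : (0 : ℝ) < m := by exact_mod_cast hm1
  have hmc : 4 * c ^ 2 ≤ m := (Nat.le_ceil _).trans (by exact_mod_cast (Nat.le_succ _).trans hm)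
  have hcs : 2 * c ≤ √(m : ℝ) := Real.le_sqrt_of_sq_le (by linarith [mul_pow 2 c 2])
  have hs : 0 < √(m : ℝ) := Real.sqrt_pos.2 hm0
  set h := √(m : ℝ) / (4 * c) with hh
  have hh0 : 0 < h := by positivity
  have hball : P.real {ω | |X m ω| ≤ h} ≤ 1 / 2 := by
    have h2 : (1 : ℝ) ≤ 2 * h := by
      rw [hh, mul_div_assoc', one_le_div (by positivity)]
      linarith
    have := hconc (2 * h) h2 m (by exact_mod_cast hm1) (-h)
    have heq : {ω | -h ≤ X m ω ∧ X m ω ≤ -h + 2 * h} = {ω | |X m ω| ≤ h} := by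
      ext ω
      simp only [Set.mem_ofPred_eq, abs_le]
      rw [show -h + 2 * h = h by ring]
    rw [heq] at this
    refine this.trans_eq ?_
    rw [hh]
    simp only [NNReal.coe_natCast]
    field_simp
    norm_num
  have hmeas : MeasurableSet {ω | |X m ω| ≤ h} :=
    measurableSet_le (hX.measurable _).abs measurable_const
  have hcompl : 1 / 2 ≤ P.real {ω | |X m ω| ≤ h}ᶜ := by
    rw [probReal_compl_eq_one_sub hmeas]
    linarith
  have hint : Integrable (fun ω ↦ |X m ω|) P := ((hvar m).integrable one_le_two).abs
  have hmk := mul_meas_ge_le_integral_of_nonneg (ae_of_all P fun ω ↦ abs_nonneg (X m ω)) hint h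
  calc 1 / (8 * c) * √(m : ℝ) = h * (1 / 2) := by rw [hh]; field_simp; norm_num
    _ ≤ h * P.real {ω | h ≤ |X m ω|} := by
        gcongr
        refine hcompl.trans (measureReal_mono fun ω hω ↦ ?_)
        simp only [Set.mem_compl_iff, Set.mem_ofPred_eq, not_le] at hω ⊢
        exact hω.le
    _ ≤ _ := hmk

end Levy

/-! ### Running maxima of centred random walks -/

section Walk

variable {Ω : Type*}

/-- Pathwise form of Doob's `L²` inequality. -/
lemma partialSups_sq_le {s : ℕ → ℝ} (h0 : s 0 = 0) (n : ℕ) :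
    (partialSups s n) ^ 2 ≤ 2 * partialSups s n * s n -
      2 * ∑ i ∈ Finset.range n, partialSups s i * (s (i + 1) - s i) := by
  induction n with
  | zero => simp [h0]
  | succ n ih =>
    rw [Finset.sum_range_succ, partialSups_add_one]
    rcases le_total (s (n + 1)) (partialSups s n) with h | h
    · rw [sup_eq_left.2 h]
      linarith
    · rw [sup_eq_right.2 h]
      nlinarith [sq_nonneg (s (n + 1) - partialSups s n)]

lemma partialSups_nonneg {s : ℕ → ℝ} (h0 : s 0 = 0) (n : ℕ) : 0 ≤ partialSups s n := by
  have := le_partialSups_of_le s (Nat.zero_le n)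
  rwa [h0] at this

/-- The walk with steps `ξ`. -/
def walk (ξ : ℕ → Ω → ℝ) (n : ℕ) (ω : Ω) : ℝ := ∑ i ∈ Finset.range n, ξ i ω

/-- The running maximum of the walk with steps `ξ`. -/
noncomputable def walkMax (ξ : ℕ → Ω → ℝ) (n : ℕ) (ω : Ω) : ℝ := partialSups (fun k ↦ walk ξ k ω) n

variable {ξ : ℕ → Ω → ℝ}

lemma walk_zero (ω : Ω) : walk ξ 0 ω = 0 := by simp [walk]

lemma walk_succ_sub (n : ℕ) (ω : Ω) : walk ξ (n + 1) ω - walk ξ n ω = ξ n ω := by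
  simp [walk, Finset.sum_range_succ]

/-- The walk and its running maximum up to time `n` are functions of the first `n` steps. -/
lemma walk_ite_mem_range {n k : ℕ} (hk : k ≤ n) (ω : Ω) :
    walk (fun i (y : ℕ → ℝ) ↦ y i) k (fun i ↦ if i ∈ Finset.range n then ξ i ω else 0) =
      walk ξ k ω := by
  refine Finset.sum_congr rfl fun i hi ↦ ?_
  have : i < n := (Finset.mem_range.1 hi).trans_le hk
  simp [this]

lemma walkMax_ite_mem_range (n : ℕ) (ω : Ω) :
    walkMax (fun i (y : ℕ → ℝ) ↦ y i) n (fun i ↦ if i ∈ Finset.range n then ξ i ω else 0) =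
      walkMax ξ n ω := by
  simp only [walkMax, partialSups_eq_sup'_range]
  refine Finset.sup'_congr _ rfl fun k hk ↦ walk_ite_mem_range ?_ ω
  exact Nat.lt_succ_iff.1 (Finset.mem_range.1 hk)

variable [MeasurableSpace Ω] {P : Measure Ω}

/-- Families obtained from an independent family by killing the variables outside of disjoint
finite sets of indices are independent. -/
lemma ProbabilityTheory.iIndepFun.indepFun_ite_mem (h : iIndepFun ξ P)
    (hm : ∀ i, Measurable (ξ i)) {S T : Finset ℕ} (hST : Disjoint S T) :
    (fun ω i ↦ if i ∈ S then ξ i ω else 0) ⟂ᵢ[P] (fun ω i ↦ if i ∈ T then ξ i ω else 0) := by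
  have hext (R : Finset ℕ) :
      Measurable fun (y : R → ℝ) (i : ℕ) ↦ if hi : i ∈ R then y ⟨i, hi⟩ else 0 := by
    refine measurable_pi_lambda _ fun i ↦ ?_
    by_cases hi : i ∈ R
    · simpa [hi] using measurable_pi_apply _
    · simp [hi]
  have := (h.indepFun_finset S T hST hm).comp (hext S) (hext T)
  simpa [Function.comp_def] using this

lemma measurable_partialSups_apply {s : ℕ → Ω → ℝ} (hs : ∀ n, Measurable (s n)) (n : ℕ) :
    Measurable fun ω ↦ partialSups (fun k ↦ s k ω) n := by
  induction n with
  | zero => simpa using hs 0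
  | succ n ih =>
    simp only [partialSups_add_one]
    exact ih.sup (hs _)

lemma memLp_partialSups_apply {s : ℕ → Ω → ℝ} {p : ENNReal} (hs : ∀ n, MemLp (s n) p P) (n : ℕ) :
    MemLp (fun ω ↦ partialSups (fun k ↦ s k ω) n) p P := by
  induction n with
  | zero => simpa using hs 0
  | succ n ih =>
    simp only [partialSups_add_one]
    exact ih.sup (hs _)

lemma measurable_walk (hm : ∀ i, Measurable (ξ i)) (n : ℕ) : Measurable (walk ξ n) :=
  Finset.measurable_fun_sum _ fun i _ ↦ hm i

lemma memLp_walk (h2 : ∀ i, MemLp (ξ i) 2 P) (n : ℕ) : MemLp (walk ξ n) 2 P :=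
  memLp_finsetSum _ fun i _ ↦ h2 i

lemma memLp_walkMax (h2 : ∀ i, MemLp (ξ i) 2 P) (n : ℕ) : MemLp (walkMax ξ n) 2 P :=
  memLp_partialSups_apply (memLp_walk h2) n

/-- The maximum up to time `i` involves only the steps before step `i`, so it is independent of that
centred step. This kills the martingale term in Doob's inequality. -/
lemma integral_walkMax_mul (hind : iIndepFun ξ P) (hm : ∀ i, Measurable (ξ i))
    (h2 : ∀ i, MemLp (ξ i) 2 P) (hmean : ∀ i, ∫ ω, ξ i ω ∂P = 0) (i : ℕ) :
    ∫ ω, walkMax ξ i ω * ξ i ω ∂P = 0 := by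
  have hcoord : ∀ i, Measurable fun y : ℕ → ℝ ↦ y i := fun i ↦ measurable_pi_apply i
  have h := (hind.indepFun_ite_mem hm (S := Finset.range i) (T := {i}) (by simp)).comp
    (φ := walkMax (fun i (y : ℕ → ℝ) ↦ y i) i) (ψ := fun y : ℕ → ℝ ↦ y i)
    (measurable_partialSups_apply (measurable_walk hcoord) i) (hcoord i)
  have h' : walkMax ξ i ⟂ᵢ[P] ξ i := by
    convert h using 1
    · ext ω
      exact (walkMax_ite_mem_range i ω).symm
    · ext ω
      simp
  rw [h'.integral_fun_mul_eq_mul_integral (memLp_walkMax h2 i).aestronglyMeasurable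
    (h2 i).aestronglyMeasurable, hmean, mul_zero]

variable [IsProbabilityMeasure P]

lemma integral_walk_sq (hind : iIndepFun ξ P) (h2 : ∀ i, MemLp (ξ i) 2 P)
    (hmean : ∀ i, ∫ ω, ξ i ω ∂P = 0) (n : ℕ) :
    ∫ ω, walk ξ n ω ^ 2 ∂P = ∑ i ∈ Finset.range n, ∫ ω, ξ i ω ^ 2 ∂P := by
  have hmean' : ∫ ω, walk ξ n ω ∂P = 0 := by
    simp only [walk]
    rw [integral_finsetSum _ fun i _ ↦ (h2 i).integrable one_le_two]
    simp [hmean]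
  rw [← variance_of_integral_eq_zero (memLp_walk h2 n).aestronglyMeasurable.aemeasurable hmean']
  have : walk ξ n = ∑ i ∈ Finset.range n, ξ i := by ext ω; simp [walk]
  rw [this, IndepFun.variance_sum (fun i _ ↦ h2 i) fun i _ j _ hij ↦ hind.indepFun hij]
  exact Finset.sum_congr rfl fun i _ ↦
    variance_of_integral_eq_zero (h2 i).aestronglyMeasurable.aemeasurable (hmean i)

/-- Doob's `L²` inequality for a centred random walk. -/
lemma integral_walkMax_sq_le (hind : iIndepFun ξ P) (hm : ∀ i, Measurable (ξ i))
    (h2 : ∀ i, MemLp (ξ i) 2 P) (hmean : ∀ i, ∫ ω, ξ i ω ∂P = 0) (n : ℕ) :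
    ∫ ω, walkMax ξ n ω ^ 2 ∂P ≤ 4 * ∑ i ∈ Finset.range n, ∫ ω, ξ i ω ^ 2 ∂P := by
  have hi (i : ℕ) : Integrable (fun ω ↦ walkMax ξ i ω * ξ i ω) P :=
    (memLp_walkMax h2 i).integrable_mul (h2 i)
  have hs : Integrable (fun ω ↦ ∑ i ∈ Finset.range n, walkMax ξ i ω * ξ i ω) P :=
    integrable_finsetSum _ fun i _ ↦ hi i
  calc ∫ ω, walkMax ξ n ω ^ 2 ∂P
      ≤ ∫ ω, (4 * walk ξ n ω ^ 2 - 4 * ∑ i ∈ Finset.range n, walkMax ξ i ω * ξ i ω) ∂P := by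
        refine integral_mono (memLp_walkMax h2 n).integrable_sq
          (((memLp_walk h2 n).integrable_sq.const_mul 4).sub (hs.const_mul 4)) fun ω ↦ ?_
        have h := partialSups_sq_le (s := fun k ↦ walk ξ k ω) (walk_zero ω) n
        simp only [walk_succ_sub] at h
        change walkMax ξ n ω ^ 2 ≤ 2 * walkMax ξ n ω * walk ξ n ω -
          2 * ∑ i ∈ Finset.range n, walkMax ξ i ω * ξ i ω at h
        change walkMax ξ n ω ^ 2 ≤ 4 * walk ξ n ω ^ 2 -
          4 * ∑ i ∈ Finset.range n, walkMax ξ i ω * ξ i ω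
        -- `2 M S ≤ M² / 2 + 2 S²`, and the half of `M²` is absorbed on the left.
        nlinarith [sq_nonneg (walkMax ξ n ω - 2 * walk ξ n ω)]
    _ = 4 * ∑ i ∈ Finset.range n, ∫ ω, ξ i ω ^ 2 ∂P := by
        rw [integral_sub ((memLp_walk h2 n).integrable_sq.const_mul 4) (hs.const_mul 4),
          integral_const_mul, integral_const_mul, integral_walk_sq hind h2 hmean,
          integral_finsetSum _ fun i _ ↦ hi i]
        simp [integral_walkMax_mul hind hm h2 hmean]

/-- The expected running maximum of a centred random walk grows at most like the square root
of time. -/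
lemma integral_walkMax_le (hind : iIndepFun ξ P) (hm : ∀ i, Measurable (ξ i))
    (h2 : ∀ i, MemLp (ξ i) 2 P) (hmean : ∀ i, ∫ ω, ξ i ω ∂P = 0) {v : ℝ}
    (hv : ∀ i, ∫ ω, ξ i ω ^ 2 ∂P = v) (n : ℕ) :
    ∫ ω, walkMax ξ n ω ∂P ≤ (4 * v + 1) * √(n : ℝ) := by
  rcases Nat.eq_zero_or_pos n with rfl | hn
  · simp [walkMax, walk_zero]
  have hs : 0 < √(n : ℝ) := Real.sqrt_pos.2 (by exact_mod_cast hn)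
  have hss : √(n : ℝ) * √(n : ℝ) = n := Real.mul_self_sqrt (by positivity)
  have h := integral_walkMax_sq_le hind hm h2 hmean n
  simp only [hv, Finset.sum_const, Finset.card_range, nsmul_eq_mul] at h
  have h1 : ∫ ω, √(n : ℝ) * walkMax ξ n ω ∂P ≤ ∫ ω, (walkMax ξ n ω ^ 2 + n) ∂P := by
    refine integral_mono (((memLp_walkMax h2 n).integrable one_le_two).const_mul _)
      ((memLp_walkMax h2 n).integrable_sq.add (integrable_const _)) fun ω ↦ ?_
    simp only
    nlinarith [sq_nonneg (walkMax ξ n ω - √(n : ℝ)), sq_nonneg (walkMax ξ n ω + √(n : ℝ))]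
  rw [integral_const_mul, integral_add (memLp_walkMax h2 n).integrable_sq (integrable_const _),
    integral_const, probReal_univ, one_smul] at h1
  refine le_of_mul_le_mul_left ?_ hs
  calc _ ≤ _ := h1
    _ ≤ 4 * (n * v) + n := by gcongr
    _ = √(n : ℝ) * ((4 * v + 1) * √(n : ℝ)) := by linear_combination -(4 * v + 1) * hss

/-- At a time when the walk is within `x` of its running maximum, the next `m` steps push the
maximum up by at least their sum minus `x`. -/
lemma measureReal_near_record_mul_le (hind : iIndepFun ξ P) (hm : ∀ i, Measurable (ξ i))
    (h2 : ∀ i, MemLp (ξ i) 2 P) (hmean : ∀ i, ∫ ω, ξ i ω ∂P = 0) (n m : ℕ) (x : ℝ) (hx : 0 ≤ x) :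
    P.real {ω | walkMax ξ n ω ≤ walk ξ n ω + x} *
        ((∫ ω, |walk ξ (n + m) ω - walk ξ n ω| ∂P) / 2 - x) ≤
      ∫ ω, walkMax ξ (n + m) ω ∂P - ∫ ω, walkMax ξ n ω ∂P := by
  have hwi (k : ℕ) : Integrable (walk ξ k) P := (memLp_walk h2 k).integrable one_le_two
  have hMi (k : ℕ) : Integrable (walkMax ξ k) P := (memLp_walkMax h2 k).integrable one_le_two
  have hw0 (k : ℕ) : ∫ ω, walk ξ k ω ∂P = 0 := by
    simp only [walk]
    rw [integral_finsetSum _ fun i _ ↦ (h2 i).integrable one_le_two]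
    simp [hmean]
  set D : Ω → ℝ := fun ω ↦ walk ξ (n + m) ω - walk ξ n ω with hD
  have hDi : Integrable D P := (hwi _).sub (hwi _)
  set A : Set Ω := {ω | walkMax ξ n ω ≤ walk ξ n ω + x} with hA
  have hMm (k : ℕ) : Measurable (walkMax ξ k) := measurable_partialSups_apply (measurable_walk hm) k
  have hAm : MeasurableSet A := measurableSet_le (hMm n) ((measurable_walk hm n).add_const x)
  -- independence
  have hcoord : ∀ i, Measurable fun y : ℕ → ℝ ↦ y i := fun i ↦ measurable_pi_apply i
  have hB : MeasurableSet {y : ℕ → ℝ | walkMax (fun i (y : ℕ → ℝ) ↦ y i) n y ≤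
      walk (fun i (y : ℕ → ℝ) ↦ y i) n y + x} :=
    measurableSet_le (measurable_partialSups_apply (measurable_walk hcoord) n)
      ((measurable_walk hcoord n).add_const x)
  have hind' := (hind.indepFun_ite_mem hm (S := Finset.range n) (T := Finset.Ico n (n + m))
      (by rw [Finset.range_eq_Ico]; exact Finset.Ico_disjoint_Ico_consecutive 0 n (n + m))).comp
    (φ := Set.indicator {y : ℕ → ℝ | walkMax (fun i (y : ℕ → ℝ) ↦ y i) n y ≤
      walk (fun i (y : ℕ → ℝ) ↦ y i) n y + x} (1 : (ℕ → ℝ) → ℝ))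
    (ψ := fun y : ℕ → ℝ ↦ max (∑ i ∈ Finset.Ico n (n + m), y i - x) 0)
    (measurable_one.indicator hB) (by fun_prop)
  have hind'' : (A.indicator (1 : Ω → ℝ)) ⟂ᵢ[P] (fun ω ↦ max (D ω - x) 0) := by
    convert hind' using 1
    · ext ω
      simp only [Function.comp_apply, Set.indicator, hA, Set.mem_ofPred_eq,
        walkMax_ite_mem_range, walk_ite_mem_range le_rfl, Pi.one_apply]
    · ext ω
      simp only [Function.comp_apply, hD, walk]
      rw [← Finset.sum_Ico_eq_sub _ (Nat.le_add_right n m),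
        Finset.sum_congr rfl fun i hi ↦ if_pos hi]
  have hpos : Integrable (fun ω ↦ max (D ω - x) 0) P := (hDi.sub (integrable_const x)).pos_part
  -- On `A` the maximum grows by at least `(D - x)⁺`, off `A` by at least `0`; `A` depends on the
  -- steps before time `n`, `D` on those after.
  have hkey : P.real A * ∫ ω, max (D ω - x) 0 ∂P ≤
      ∫ ω, walkMax ξ (n + m) ω ∂P - ∫ ω, walkMax ξ n ω ∂P := by
    have h1 := hind''.integral_fun_mul_eq_mul_integral
      (aestronglyMeasurable_one.indicator hAm) hpos.aestronglyMeasurable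
    rw [integral_indicator_one hAm] at h1
    rw [← h1, ← integral_sub (hMi _) (hMi _)]
    have hle (ω : Ω) : walkMax ξ n ω ≤ walkMax ξ (n + m) ω :=
      (partialSups fun k ↦ walk ξ k ω).monotone (Nat.le_add_right n m)
    refine integral_mono ?_ ((hMi _).sub (hMi _)) fun ω ↦ ?_
    · have : (fun ω ↦ A.indicator (1 : Ω → ℝ) ω * max (D ω - x) 0) =
          A.indicator fun ω ↦ max (D ω - x) 0 := by
        ext ω
        by_cases h : ω ∈ A <;> simp [h]
      rw [this]
      exact hpos.indicator hAm
    · by_cases h : ω ∈ A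
      · simp only [Set.indicator_of_mem h, Pi.one_apply, one_mul]
        have h2 : walk ξ (n + m) ω ≤ walkMax ξ (n + m) ω := le_partialSups (fun k ↦ walk ξ k ω) _
        have h3 : walkMax ξ n ω ≤ walk ξ n ω + x := h
        exact max_le (by simp only [hD]; linarith) (sub_nonneg.2 (hle ω))
      · simpa [h] using hle ω
  refine (mul_le_mul_of_nonneg_left ?_ measureReal_nonneg).trans hkey
  have hD0 : ∫ ω, D ω ∂P = 0 := by rw [hD, integral_sub (hwi _) (hwi _), hw0, hw0, sub_zero]
  -- Half of `E|D|` is `E D⁺`, because `D` is centred, and `D⁺ - x ≤ (D - x)⁺`.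
  calc (∫ ω, |D ω| ∂P) / 2 - x = ∫ ω, ((|D ω| + D ω) / 2 - x) ∂P := by
        have hi : Integrable (fun ω ↦ (|D ω| + D ω) / 2) P := (hDi.abs.add hDi).div_const 2
        rw [integral_sub hi (integrable_const x),
          integral_div, integral_add hDi.abs hDi, hD0, integral_const, probReal_univ]
        simp
    _ ≤ _ := by
        refine integral_mono (((hDi.abs.add hDi).div_const 2).sub (integrable_const x)) hpos
          fun ω ↦ ?_
        simp only
        rcases abs_cases (D ω) with ⟨h, _⟩ | ⟨h, _⟩ <;> rw [h]
        · exact le_max_of_le_left (by linarith)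
        · exact le_max_of_le_right (by linarith)

end Walk

/-! ### Survival probabilities of random walks -/

section Survival

lemma walk_reverse {Ω : Type*} {ξ : ℕ → Ω → ℝ} {n j : ℕ} (hj : j ≤ n) (ω : Ω) :
    walk (fun i ↦ ξ (n - 1 - i)) j ω = walk ξ n ω - walk ξ (n - j) ω := by
  have := Finset.sum_range_sub' (fun i ↦ walk ξ (n - i) ω) j
  rw [Nat.sub_zero] at this
  rw [← this, walk]
  refine Finset.sum_congr rfl fun i hi ↦ ?_
  have hi' : i < j := Finset.mem_range.1 hi
  rw [← walk_succ_sub (ξ := ξ) (n - 1 - i) ω, show n - 1 - i + 1 = n - i by omega,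
    show n - 1 - i = n - (i + 1) by omega]

variable {Ω : Type*} [MeasurableSpace Ω] {P : Measure Ω} {ξ η : ℕ → Ω → ℝ}

/-- The probability that a walk stays above a level depends on the joint law of its steps only. -/
lemma measureReal_forall_le_walk_congr {n : ℕ} (hξ : iIndepFun (fun i : Fin n ↦ ξ i) P)
    (hη : iIndepFun (fun i : Fin n ↦ η i) P) (h : ∀ i < n, IdentDistrib (ξ i) (η i) P P) (x : ℝ) :
    P.real {ω | ∀ j ≤ n, -x ≤ walk ξ j ω} = P.real {ω | ∀ j ≤ n, -x ≤ walk η j ω} := by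
  have hid := IdentDistrib.pi (fun i : Fin n ↦ h i i.2) hξ hη
  have hB : MeasurableSet
      {y : Fin n → ℝ | ∀ j ≤ n, -x ≤ ∑ i : Fin n, if i < j then y i else 0} := by
    have : {y : Fin n → ℝ | ∀ j ≤ n, -x ≤ ∑ i : Fin n, if i < j then y i else 0} =
        ⋂ j ∈ Set.Iic n, {y : Fin n → ℝ | -x ≤ ∑ i : Fin n, if i < j then y i else 0} := by
      ext y
      simp
    rw [this]
    refine MeasurableSet.biInter (Set.to_countable _) fun j _ ↦ ?_
    refine measurableSet_le measurable_const (Finset.measurable_fun_sum _ fun i _ ↦ ?_)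
    by_cases hi : i < j
    · simpa [hi] using measurable_pi_apply i
    · simp [hi]
  have hpre (ζ : ℕ → Ω → ℝ) : {ω | ∀ j ≤ n, -x ≤ walk ζ j ω} = (fun ω (i : Fin n) ↦ ζ i ω) ⁻¹'
      {y : Fin n → ℝ | ∀ j ≤ n, -x ≤ ∑ i : Fin n, if i < j then y i else 0} := by
    ext ω
    simp only [Set.mem_ofPred_eq, Set.mem_preimage]
    refine forall₂_congr fun j hj ↦ ?_
    rw [Fin.sum_univ_eq_sum_range (fun i ↦ if i < j then ζ i ω else 0) n, ← Finset.sum_filter]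
    have : (Finset.range n).filter (· < j) = Finset.range j := by
      ext i
      simp only [Finset.mem_filter, Finset.mem_range]
      omega
    rw [this, walk]
  rw [hpre, hpre, Measure.real, Measure.real, hid.measure_mem_eq hB]

/-- Duality by time reversal. -/
lemma measureReal_near_record_eq (hind : iIndepFun ξ P)
    (hid : ∀ i j, IdentDistrib (ξ i) (ξ j) P P) (n : ℕ) (x : ℝ) :
    P.real {ω | walkMax ξ n ω ≤ walk ξ n ω + x} = P.real {ω | ∀ j ≤ n, -x ≤ walk ξ j ω} := by
  have hset : {ω | walkMax ξ n ω ≤ walk ξ n ω + x} =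
      {ω | ∀ j ≤ n, -x ≤ walk (fun i ↦ ξ (n - 1 - i)) j ω} := by
    ext ω
    simp only [Set.mem_ofPred_eq]
    constructor
    · intro h j hj
      rw [walk_reverse hj]
      have : walk ξ (n - j) ω ≤ walkMax ξ n ω :=
        le_partialSups_of_le (fun k ↦ walk ξ k ω) (Nat.sub_le n j)
      linarith
    · intro h
      refine partialSups_le _ _ _ fun j hj ↦ ?_
      have := h (n - j) (Nat.sub_le n j)
      rw [walk_reverse (Nat.sub_le n j), Nat.sub_sub_self hj] at this
      linarith
  rw [hset]
  -- With truncated subtraction, `n - 1 - i` is injective only on `i < n`; so only the first `n`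
  -- reversed steps form an independent family.
  refine measureReal_forall_le_walk_congr
    (hind.precomp (g := fun i : Fin n ↦ n - 1 - (i : ℕ)) fun i j hij ↦ ?_)
    (hind.precomp Fin.val_injective) (fun i _ ↦ hid _ _) x
  ext
  have := i.2
  have := j.2
  simp only at hij
  omega

variable [IsProbabilityMeasure P]

/-- A telescoping estimate for monotone sequences. -/
lemma sum_range_sub_shift_le {a : ℕ → ℝ} (ha : Monotone a) (h0 : 0 ≤ a 0) (N m : ℕ) :
    ∑ n ∈ Finset.range N, (a (n + m) - a n) ≤ m * a (N + m) := by
  have h1 : ∑ n ∈ Finset.range N, (a (n + m) - a n) =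
      ∑ k ∈ Finset.range m, (a (N + k) - a k) := by
    rw [Finset.sum_sub_distrib, Finset.sum_sub_distrib]
    have h2 := Finset.sum_range_add a m N
    have h3 := Finset.sum_range_add a N m
    rw [add_comm m N] at h2
    simp only [add_comm m] at h2
    linarith
  rw [h1]
  calc ∑ k ∈ Finset.range m, (a (N + k) - a k) ≤ ∑ _k ∈ Finset.range m, a (N + m) := by
        refine Finset.sum_le_sum fun k hk ↦ ?_
        have h2 := ha (Nat.add_le_add_left (Finset.mem_range.1 hk).le N)
        have h3 := ha (Nat.zero_le k)
        linarith
    _ = _ := by simp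

/-- The probability that a centred square integrable random walk stays above `-x` up to time `n`
is at most of order `(x + 1) / √n`. -/
theorem exists_measureReal_forall_le_walk_le (hind : iIndepFun ξ P) (hm : ∀ i, Measurable (ξ i))
    (hid : ∀ i j, IdentDistrib (ξ i) (ξ j) P P)
    (h2 : ∀ i, MemLp (ξ i) 2 P) (hmean : ∀ i, ∫ ω, ξ i ω ∂P = 0)
    {b : ℝ} (hb : 0 < b) {m₀ : ℕ}
    (habs : ∀ m, m₀ ≤ m → ∀ n, b * √(m : ℝ) ≤ ∫ ω, |walk ξ (n + m) ω - walk ξ n ω| ∂P) :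
    ∃ c : ℝ, 0 < c ∧ ∀ x : ℝ, 0 ≤ x → ∀ n : ℕ, 0 < n →
      P.real {ω | ∀ j ≤ n, -x ≤ walk ξ j ω} ≤ c * ((x + 1) / √(n : ℝ)) := by
  set v := ∫ ω, ξ 0 ω ^ 2 ∂P with hv
  have hv0 : 0 ≤ v := integral_nonneg fun ω ↦ sq_nonneg _
  have hvi (i : ℕ) : ∫ ω, ξ i ω ^ 2 ∂P = v := (hid i 0).sq.integral_eq
  set K := 4 * v + 1 with hK
  have hK0 : 0 < K := by positivity
  set L : ℝ := m₀ + 16 / b ^ 2 + 1 with hL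
  have hL1 : 1 ≤ L := by
    have : 0 ≤ (m₀ : ℝ) + 16 / b ^ 2 := by positivity
    linarith
  have hL0 : 0 < L := one_pos.trans_le hL1
  refine ⟨2 * K * L + L, by positivity, fun x hx N hN ↦ ?_⟩
  -- The block length makes `b √m ≥ 4 (x + 1)`, so that half of it still exceeds `x` by at least `x
  -- + 1`, while `m` stays of order `(x + 1)²`.
  set m : ℕ := m₀ + ⌈16 / b ^ 2 * (x + 1) ^ 2⌉₊ with hmdef
  have hx1 : 1 ≤ x + 1 := by linarith
  have hx2 : 1 ≤ (x + 1) ^ 2 := one_le_pow₀ hx1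
  have hmL : (m : ℝ) ≤ L * (x + 1) ^ 2 := by
    have h1 := (Nat.ceil_lt_add_one (show 0 ≤ 16 / b ^ 2 * (x + 1) ^ 2 by positivity)).le
    have h2 : (m₀ : ℝ) ≤ m₀ * (x + 1) ^ 2 := le_mul_of_one_le_right (by positivity) hx2
    rw [hmdef, hL]
    push_cast
    nlinarith
  have hbm : 4 * (x + 1) ≤ b * √(m : ℝ) := by
    have h1 : (4 * (x + 1) / b) ^ 2 ≤ m := by
      have := Nat.le_ceil (16 / b ^ 2 * (x + 1) ^ 2)
      rw [hmdef]
      push_cast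
      calc (4 * (x + 1) / b) ^ 2 = 16 / b ^ 2 * (x + 1) ^ 2 := by ring
        _ ≤ _ := this
        _ ≤ _ := le_add_of_nonneg_left (by positivity)
    have h2 := Real.le_sqrt_of_sq_le h1
    rwa [div_le_iff₀ hb, mul_comm (√(m : ℝ))] at h2
  set F : ℕ → ℝ := fun n ↦ P.real {ω | ∀ j ≤ n, -x ≤ walk ξ j ω} with hF
  set a : ℕ → ℝ := fun n ↦ ∫ ω, walkMax ξ n ω ∂P with ha
  have hMi (k : ℕ) : Integrable (walkMax ξ k) P := (memLp_walkMax h2 k).integrable one_le_two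
  have ha_mono : Monotone a := fun k l hkl ↦ integral_mono (hMi k) (hMi l) fun ω ↦
    (partialSups fun k ↦ walk ξ k ω).monotone hkl
  have ha0 : 0 ≤ a 0 := integral_nonneg fun ω ↦ partialSups_nonneg (walk_zero ω) 0
  have hstep (n : ℕ) : F n * (x + 1) ≤ a (n + m) - a n := by
    have h := measureReal_near_record_mul_le hind hm h2 hmean n m x hx
    rw [measureReal_near_record_eq hind hid] at h
    refine (mul_le_mul_of_nonneg_left ?_ measureReal_nonneg).trans h
    have := habs m (Nat.le_add_right _ _) n
    linarith
  have hFanti {k : ℕ} (hk : k ≤ N) : F N ≤ F k :=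
    measureReal_mono fun ω hω j hj ↦ hω j (hj.trans hk)
  have hsum : N * (F N * (x + 1)) ≤ m * (K * √((N + m : ℕ) : ℝ)) := by
    calc N * (F N * (x + 1)) = ∑ _n ∈ Finset.range N, F N * (x + 1) := by simp
      _ ≤ ∑ n ∈ Finset.range N, (a (n + m) - a n) := by
          refine Finset.sum_le_sum fun n hn ↦ le_trans ?_ (hstep n)
          gcongr
          exact hFanti (Finset.mem_range.1 hn).le
      _ ≤ m * a (N + m) := sum_range_sub_shift_le ha_mono ha0 N m
      _ ≤ _ := by
          gcongr
          exact integral_walkMax_le hind hm h2 hmean hvi (N + m)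
  have hN0 : (0 : ℝ) < N := by exact_mod_cast hN
  have hs : 0 < √(N : ℝ) := Real.sqrt_pos.2 hN0
  have hss : √(N : ℝ) * √(N : ℝ) = N := Real.mul_self_sqrt hN0.le
  change F N ≤ _
  rcases le_total m N with hmN | hNm
  · have hsq : √((N + m : ℕ) : ℝ) ≤ 2 * √(N : ℝ) := by
      rw [Real.sqrt_le_left (by positivity), mul_pow, Real.sq_sqrt hN0.le]
      have : (m : ℝ) ≤ N := by exact_mod_cast hmN
      push_cast
      linarith
    have h3 : √(N : ℝ) * (x + 1) * (F N * √(N : ℝ)) ≤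
        √(N : ℝ) * (x + 1) * (2 * K * L * (x + 1)) := by
      calc √(N : ℝ) * (x + 1) * (F N * √(N : ℝ)) = N * (F N * (x + 1)) := by
            linear_combination F N * (x + 1) * hss
        _ ≤ _ := hsum
        _ ≤ L * (x + 1) ^ 2 * (K * (2 * √(N : ℝ))) := by gcongr
        _ = _ := by ring
    have h4 := le_of_mul_le_mul_left h3 (by positivity)
    rw [mul_div_assoc', le_div_iff₀ hs]
    refine h4.trans ?_
    gcongr
    linarith
  -- Before one block length has elapsed, the claimed bound is at least `1`.
  · have h5 : √(N : ℝ) ≤ L * (x + 1) := by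
      rw [Real.sqrt_le_left (by positivity)]
      calc (N : ℝ) ≤ m := by exact_mod_cast hNm
        _ ≤ L * (x + 1) ^ 2 := hmL
        _ ≤ L * L * (x + 1) ^ 2 := by
          gcongr
          exact le_mul_of_one_le_left hL0.le hL1
        _ = _ := by ring
    calc F N ≤ 1 := measureReal_le_one
      _ ≤ L * (x + 1) / √(N : ℝ) := (one_le_div hs).2 h5
      _ = L * ((x + 1) / √(N : ℝ)) := by ring
      _ ≤ _ := by
          gcongr
          have : 0 ≤ 2 * K * L := by positivity
          linarith

end Survival

/-! ### Path regularity and the three-piece decomposition -/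

section Bounds

variable {Ω : Type*} [MeasurableSpace Ω] {P : Measure Ω} {X : ℝ≥0 → Ω → ℝ}

/-- Paths with left and right limits are bounded below on compact time intervals. -/
lemma bddBelow_image_Icc_of_cadlag {f : ℝ≥0 → ℝ} (hf : ∀ t : ℝ≥0,
    ContinuousWithinAt f (Set.Ici t) t ∧ ∃ l : ℝ, Tendsto f (𝓝[<] t) (𝓝 l)) (t : ℝ≥0) :
    BddBelow (f '' Set.Icc 0 t) := by
  refine isCompact_Icc.induction_on (p := fun s ↦ BddBelow (f '' s)) (by simp)
    (fun s u hsu hu ↦ hu.mono (Set.image_mono hsu)) (fun s u hs hu ↦ ?_) fun s _ ↦ ?_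
  · rw [Set.image_union]
    exact hs.union hu
  · obtain ⟨h1, l, h2⟩ := hf s
    have h3 : ∀ᶠ u in 𝓝 s, min (f s) l - 1 ≤ f u := by
      rw [← nhdsLT_sup_nhdsGE, eventually_sup]
      exact ⟨h2.eventually (eventually_ge_nhds (by linarith [min_le_right (f s) l])),
        h1.eventually (eventually_ge_nhds (by linarith [min_le_left (f s) l]))⟩
    refine ⟨_, mem_nhdsWithin_of_mem_nhds h3, min (f s) l - 1, ?_⟩
    rintro _ ⟨u, hu, rfl⟩
    exact hu

/-- A real `⨅` over a set unbounded below has the default value `0`, so the càdlàg property is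
needed to make the infimum a lower bound. -/
lemma IsLevyProcess.ae_runningInf_le (hX : IsLevyProcess X P) :
    ∀ᵐ ω ∂P, ∀ s t : ℝ≥0, s ≤ t → runningInf X t ω ≤ X s ω := by
  filter_upwards [hX.cadlag] with ω hω s t hst
  have hb := bddBelow_image_Icc_of_cadlag hω t
  rw [Set.image_eq_range] at hb
  exact ciInf_le hb ⟨s, zero_le, hst⟩

variable [IsProbabilityMeasure P]

/-- A concentration bound for `V` persists on events and levels given by an independent
variable `Y`. -/
lemma measureReal_le_of_indepFun {α : Type*} [MeasurableSpace α] {Y : Ω → α} {V : Ω → ℝ}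
    (hYV : Y ⟂ᵢ[P] V) (hY : Measurable Y) (hV : Measurable V) {D : Set α} (hD : MeasurableSet D)
    {φ : α → ℝ} (hφ : Measurable φ) {h q : ℝ}
    (hq : ∀ r, P.real {ω | r ≤ V ω ∧ V ω ≤ r + h} ≤ q) :
    P.real {ω | Y ω ∈ D ∧ φ (Y ω) ≤ V ω ∧ V ω ≤ φ (Y ω) + h} ≤ q * P.real (Y ⁻¹' D) := by
  have hq0 : 0 ≤ q := measureReal_nonneg.trans (hq 0)
  set B : Set (α × ℝ) := {p | p.1 ∈ D ∧ φ p.1 ≤ p.2 ∧ p.2 ≤ φ p.1 + h} with hB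
  have hBm : MeasurableSet B :=
    (measurable_fst hD).inter ((measurableSet_le (hφ.comp measurable_fst) measurable_snd).inter
      (measurableSet_le measurable_snd ((hφ.comp measurable_fst).add_const h)))
  have hle : P {ω | Y ω ∈ D ∧ φ (Y ω) ≤ V ω ∧ V ω ≤ φ (Y ω) + h} ≤
      ENNReal.ofReal q * P (Y ⁻¹' D) := by
    have h1 : P {ω | Y ω ∈ D ∧ φ (Y ω) ≤ V ω ∧ V ω ≤ φ (Y ω) + h} =
        ((P.map Y).prod (P.map V)) B := by
      rw [← hYV.map_prod_eq_prod_map_map hY.aemeasurable hV.aemeasurable,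
        Measure.map_apply (hY.prodMk hV) hBm]
      rfl
    rw [h1, Measure.prod_apply hBm]
    calc ∫⁻ y, P.map V (Prod.mk y ⁻¹' B) ∂(P.map Y)
        ≤ ∫⁻ y, D.indicator (fun _ ↦ ENNReal.ofReal q) y ∂(P.map Y) := by
          refine lintegral_mono fun y ↦ ?_
          by_cases hy : y ∈ D
          · rw [Set.indicator_of_mem hy, Measure.map_apply hV (measurable_prodMk_left hBm)]
            have h2 := hq (φ y)
            rw [Measure.real, ← ENNReal.le_ofReal_iff_toReal_le (measure_ne_top _ _) hq0] at h2
            refine (measure_mono fun ω hω ↦ ?_).trans h2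
            exact hω.2
          · have : Prod.mk y ⁻¹' B = ∅ := by
              ext v
              simp [hB, hy]
            simp [this]
      _ = ENNReal.ofReal q * P (Y ⁻¹' D) := by
          rw [lintegral_indicator_const hD, Measure.map_apply hY hD]
  have := ENNReal.toReal_mono (ENNReal.mul_ne_top ENNReal.ofReal_ne_top (measure_ne_top _ _)) hle
  rwa [ENNReal.toReal_mul, ENNReal.toReal_ofReal hq0] at this

lemma measurableSet_forall_le_walk {ξ : ℕ → Ω → ℝ} (hm : ∀ i, Measurable (ξ i)) (n : ℕ) (x : ℝ) :
    MeasurableSet {ω | ∀ j ≤ n, -x ≤ walk ξ j ω} := by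
  have : {ω | ∀ j ≤ n, -x ≤ walk ξ j ω} = ⋂ j ∈ Set.Iic n, {ω | -x ≤ walk ξ j ω} := by
    ext ω
    simp
  rw [this]
  exact MeasurableSet.biInter (Set.to_countable _) fun j _ ↦
    measurableSet_le measurable_const (measurable_walk hm j)

/-- For independent steps `ζ 0, …, ζ (2 n)`, the first `n` steps, the middle step and the last `n`
steps contribute independently. -/
lemma measureReal_three_parts_le {ζ : ℕ → Ω → ℝ} (hind : iIndepFun ζ P)
    (hm : ∀ i, Measurable (ζ i)) (n : ℕ) {h q : ℝ}
    (hq : ∀ r, P.real {ω | r ≤ ζ n ω ∧ ζ n ω ≤ r + h} ≤ q) (x y g : ℝ) :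
    P.real {ω | (∀ j ≤ n, -x ≤ walk ζ j ω) ∧ (∀ j ≤ n, -y ≤ walk (fun i ω ↦ -ζ (2 * n - i) ω) j ω) ∧
        g ≤ walk ζ n ω + ζ n ω - walk (fun i ω ↦ -ζ (2 * n - i) ω) n ω ∧
        walk ζ n ω + ζ n ω - walk (fun i ω ↦ -ζ (2 * n - i) ω) n ω ≤ g + h} ≤
      q * (P.real {ω | ∀ j ≤ n, -x ≤ walk ζ j ω} *
        P.real {ω | ∀ j ≤ n, -y ≤ walk (fun i ω ↦ -ζ (2 * n - i) ω) j ω}) := by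
  set S := Finset.range n with hS
  set T := Finset.Ico (n + 1) (2 * n + 1) with hT
  have hST : Disjoint S T := by
    rw [Finset.disjoint_left]
    intro i hi hi'
    simp only [hS, hT, Finset.mem_range, Finset.mem_Ico] at hi hi'
    omega
  have hSTn : Disjoint (S ∪ T) {n} := by
    rw [Finset.disjoint_singleton_right]
    simp [hS, hT]
  have hcoord : ∀ i, Measurable fun y : ℕ → ℝ ↦ y i := fun i ↦ measurable_pi_apply i
  have hcoord' : ∀ i, Measurable fun y : ℕ → ℝ ↦ -y (2 * n - i) := fun i ↦ (hcoord _).neg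
  set U : Finset ℕ → Ω → ℕ → ℝ := fun R ω i ↦ if i ∈ R then ζ i ω else 0 with hU
  have hUm (R : Finset ℕ) : Measurable (U R) := by
    refine measurable_pi_lambda _ fun i ↦ ?_
    by_cases hi : i ∈ R
    · simpa [hU, hi] using hm i
    · simp [hU, hi]
  -- the two walks as functions of the restricted families
  have hfor {R : Finset ℕ} (hR : S ⊆ R) {j : ℕ} (hj : j ≤ n) (ω : Ω) :
      walk (fun i (y : ℕ → ℝ) ↦ y i) j (U R ω) = walk ζ j ω := by
    refine Finset.sum_congr rfl fun i hi ↦ if_pos (hR ?_)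
    simp only [hS, Finset.mem_range] at hi ⊢
    omega
  have hback {R : Finset ℕ} (hR : T ⊆ R) {j : ℕ} (hj : j ≤ n) (ω : Ω) :
      walk (fun i (y : ℕ → ℝ) ↦ -y (2 * n - i)) j (U R ω) =
        walk (fun i ω ↦ -ζ (2 * n - i) ω) j ω := by
    refine Finset.sum_congr rfl fun i hi ↦ congrArg Neg.neg (if_pos (hR ?_))
    simp only [hT, Finset.mem_range, Finset.mem_Ico] at hi ⊢
    omega
  set A : Set (ℕ → ℝ) := {y | ∀ j ≤ n, -x ≤ walk (fun i (y : ℕ → ℝ) ↦ y i) j y} with hA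
  set B : Set (ℕ → ℝ) := {z | ∀ j ≤ n, -y ≤ walk (fun i (y : ℕ → ℝ) ↦ -y (2 * n - i)) j z} with hB
  have hAm : MeasurableSet A := measurableSet_forall_le_walk hcoord n x
  have hBm : MeasurableSet B := measurableSet_forall_le_walk hcoord' n y
  have hApre {R : Finset ℕ} (hR : S ⊆ R) :
      U R ⁻¹' A = {ω | ∀ j ≤ n, -x ≤ walk ζ j ω} := by
    ext ω
    exact forall₂_congr fun j hj ↦ by rw [hfor hR hj]
  have hBpre {R : Finset ℕ} (hR : T ⊆ R) :
      U R ⁻¹' B = {ω | ∀ j ≤ n, -y ≤ walk (fun i ω ↦ -ζ (2 * n - i) ω) j ω} := by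
    ext ω
    exact forall₂_congr fun j hj ↦ by rw [hback hR hj]
  have hlSR : S ⊆ S ∪ T := Finset.subset_union_left
  have hrTR : T ⊆ S ∪ T := Finset.subset_union_right
  have hind1 : U S ⟂ᵢ[P] U T := hind.indepFun_ite_mem hm hST
  have hind2 : U (S ∪ T) ⟂ᵢ[P] ζ n := by
    have := (hind.indepFun_ite_mem hm hSTn).comp (φ := id) (ψ := fun y : ℕ → ℝ ↦ y n)
      measurable_id (hcoord n)
    convert this using 1
    · rfl
    · ext ω
      simp
  -- Both outer events are read off the single family `U (S ∪ T)`, which is independent of the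
  -- middle step, and are then reread from `U S` and `U T` to factorise.
  have hprod : P.real (U (S ∪ T) ⁻¹' (A ∩ B)) = P.real {ω | ∀ j ≤ n, -x ≤ walk ζ j ω} *
      P.real {ω | ∀ j ≤ n, -y ≤ walk (fun i ω ↦ -ζ (2 * n - i) ω) j ω} := by
    rw [Set.preimage_inter, hApre hlSR, hBpre hrTR, ← hApre subset_rfl, ← hBpre subset_rfl,
      Measure.real, hind1.measure_inter_preimage_eq_mul _ _ hAm hBm, ENNReal.toReal_mul]
    rfl
  rw [← hprod]
  -- Given the outer steps, the endpoint condition confines the middle step to a window of length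
  -- `h` with left end `φ`.
  refine le_trans (measureReal_mono fun ω hω ↦ ?_) (measureReal_le_of_indepFun hind2 (hUm _) (hm n)
    (hAm.inter hBm) (φ := fun z ↦ g - walk (fun i (y : ℕ → ℝ) ↦ y i) n z +
      walk (fun i (y : ℕ → ℝ) ↦ -y (2 * n - i)) n z)
    ((measurable_const.sub (measurable_walk hcoord n)).add (measurable_walk hcoord' n)) hq)
  obtain ⟨h1, h2, h3, h4⟩ := hω
  refine ⟨⟨?_, ?_⟩, ?_, ?_⟩
  · change ω ∈ U (S ∪ T) ⁻¹' A
    rwa [hApre hlSR]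
  · change ω ∈ U (S ∪ T) ⁻¹' B
    rwa [hBpre hrTR]
  · rw [hfor hlSR le_rfl, hback hrTR le_rfl]
    linarith
  · rw [hfor hlSR le_rfl, hback hrTR le_rfl]
    linarith

/-- Survival estimate along any family of independent copies of the increment `X 1`. -/
lemma IsLevyProcess.exists_measureReal_forall_le_walk_le (hX : IsLevyProcess X P)
    (hvar : ∀ t : ℝ≥0, MemLp (X t) 2 P) (hmean : ∀ t : ℝ≥0, ∫ ω, X t ω ∂P = 0)
    (hnondeg : 0 < Var[X 1; P]) :
    ∃ c : ℝ, 0 < c ∧ ∀ x : ℝ, 0 ≤ x → ∀ n : ℕ, 0 < n → ∀ η : ℕ → Ω → ℝ,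
      iIndepFun (fun i : Fin n ↦ η i) P → (∀ i < n, IdentDistrib (η i) (X 1) P P) →
      P.real {ω | ∀ j ≤ n, -x ≤ walk η j ω} ≤ c * ((x + 1) / √(n : ℝ)) := by
  set ξ : ℕ → Ω → ℝ := fun i ω ↦ X ((i + 1 : ℕ) : ℝ≥0) ω - X (i : ℝ≥0) ω with hξ
  have hind : iIndepFun ξ P := hX.indepIncrements.nat Nat.mono_cast
  have hid (i : ℕ) : IdentDistrib (ξ i) (X 1) P P := by
    have := hX.stationaryIncrements i 1
    simp only [hξ, Nat.cast_succ]
    exact this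
  have hwalk (n : ℕ) (ω : Ω) : walk ξ n ω = X n ω - X 0 ω := by
    have := Finset.sum_range_sub (fun i : ℕ ↦ X (i : ℝ≥0) ω) n
    rwa [Nat.cast_zero] at this
  obtain ⟨b, hb, m₀, habs⟩ := hX.exists_le_integral_abs hvar (hmean 1) hnondeg
  obtain ⟨c, hc, h⟩ := _root_.exists_measureReal_forall_le_walk_le hind
    (fun i ↦ (hX.measurable _).sub (hX.measurable _)) (fun i j ↦ (hid i).trans (hid j).symm)
    (fun i ↦ (hvar _).sub (hvar _)) (fun i ↦ (hid i).integral_eq.trans (hmean 1)) hb (m₀ := m₀)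
    fun m hm n ↦ by
      refine (habs m hm).trans_eq ?_
      have h1 := ((hX.stationaryIncrements n m).comp measurable_id.abs).integral_eq
      simp only [Function.comp_apply, id, Pi.sub_apply] at h1
      rw [← h1]
      congr with ω
      rw [hwalk, hwalk, Nat.cast_add]
      congr 1
      ring
  refine ⟨c, hc, fun x hx n hn η hη hηid ↦ ?_⟩
  rw [measureReal_forall_le_walk_congr hη (hind.precomp Fin.val_injective)
    fun i hi ↦ (hηid i hi).trans (hid i).symm]
  exact h x hx n hn

/-- Truncation at `s` costs nothing for a probability once the constant is at least `1`; this
explains the `+ 1` or `+ 2` in later constants. -/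
lemma le_mul_min_div {p C a s : ℝ} (hp : p ≤ 1) (hC : 1 ≤ C) (hs : 0 < s) (h : p ≤ C * (a / s)) :
    p ≤ C * (min a s / s) := by
  rcases le_total a s with h1 | h1
  · rwa [min_eq_left h1]
  · rw [min_eq_right h1, div_self hs.ne', mul_one]
    exact hp.trans hC

lemma half_le_min_div {a s : ℝ} (ha : 1 ≤ a) (hs : 0 < s) (hs2 : s ≤ 2) : 1 / 2 ≤ min a s / s := by
  rw [le_div_iff₀ hs]
  exact le_min (by linarith) (by linarith)

lemma rpow_three_halves_eq {t : ℝ} (ht : 0 ≤ t) : t ^ (3 / 2 : ℝ) = √t ^ 3 := by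
  rw [Real.sqrt_eq_rpow, ← Real.rpow_natCast, ← Real.rpow_mul ht]
  norm_num

end Bounds

/-! ### Estimates for the Lévy process in continuous time -/

section Main

variable {Ω : Type*} [MeasurableSpace Ω] {P : Measure Ω} [IsProbabilityMeasure P]
  {X : ℝ≥0 → Ω → ℝ}

/-- The unit time grid `0, 1, …, n, t - n, …, t - 1, t, t, …`. -/
noncomputable def twoSidedGrid (n : ℕ) (t : ℝ≥0) (k : ℕ) : ℝ≥0 :=
  if k ≤ n then (k : ℝ≥0) else t - ((2 * n + 1 - k : ℕ) : ℝ≥0)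

lemma twoSidedGrid_of_le {n k : ℕ} (t : ℝ≥0) (hk : k ≤ n) : twoSidedGrid n t k = k := if_pos hk

lemma twoSidedGrid_sub {n j : ℕ} (t : ℝ≥0) (hj : j ≤ n) :
    twoSidedGrid n t (2 * n + 1 - j) = t - j := by
  rw [twoSidedGrid, if_neg (by omega), show 2 * n + 1 - (2 * n + 1 - j) = j by omega]

/-- Only the middle gap, from `n` to `t - n`, needs `2 n ≤ t`. Monotonicity is what makes the
increments along the grid independent. -/
lemma monotone_twoSidedGrid {n : ℕ} {t : ℝ≥0} (hn : (2 * n : ℝ≥0) ≤ t) :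
    Monotone (twoSidedGrid n t) := by
  refine monotone_nat_of_le_succ fun k ↦ ?_
  rcases lt_trichotomy k n with h | rfl | h
  · rw [twoSidedGrid_of_le t h.le, twoSidedGrid_of_le t (Nat.succ_le_of_lt h)]
    exact_mod_cast Nat.le_succ k
  · rw [twoSidedGrid_of_le t le_rfl, show k + 1 = 2 * k + 1 - k by omega,
      twoSidedGrid_sub t le_rfl]
    refine le_tsub_of_add_le_right ?_
    rwa [← two_mul]
  · rw [twoSidedGrid, twoSidedGrid, if_neg (by omega), if_neg (by omega)]
    refine tsub_le_tsub_left ?_ t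
    exact_mod_cast Nat.sub_le_sub_left (Nat.le_succ k) _

/-- Survival estimate for the running infimum. -/
lemma IsLevyProcess.exists_measureReal_le_runningInf_le (hX : IsLevyProcess X P)
    (hvar : ∀ t : ℝ≥0, MemLp (X t) 2 P) (hmean : ∀ t : ℝ≥0, ∫ ω, X t ω ∂P = 0)
    (hnondeg : 0 < Var[X 1; P]) :
    ∃ c : ℝ, 0 < c ∧ ∀ x : ℝ, 0 ≤ x → ∀ t : ℝ≥0, 0 < t →
      P.real {ω | -x ≤ runningInf X t ω} ≤ c * (min (x + 1) √(t : ℝ) / √(t : ℝ)) := by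
  obtain ⟨c, hc, h⟩ := hX.exists_measureReal_forall_le_walk_le hvar hmean hnondeg
  refine ⟨2 * c + 2, by positivity, fun x hx t ht ↦ ?_⟩
  have ht0 : (0 : ℝ) < t := by exact_mod_cast ht
  have hs : 0 < √(t : ℝ) := Real.sqrt_pos.2 ht0
  rcases lt_or_ge t 1 with h1 | h1
  · have := half_le_min_div (a := x + 1) (by linarith) hs
      ((Real.sqrt_le_one.2 (by exact_mod_cast h1.le)).trans one_le_two)
    refine measureReal_le_one.trans ?_
    nlinarith
  refine le_mul_min_div measureReal_le_one (by linarith) hs ?_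
  set n := ⌊t⌋₊ with hn
  have hnt : (n : ℝ≥0) ≤ t := Nat.floor_le zero_le
  have hn1 : 1 ≤ n := Nat.one_le_floor_iff _ |>.2 h1
  have hn0 : (0 : ℝ) < n := by exact_mod_cast hn1
  have htn : (t : ℝ) ≤ 4 * n := by
    have h1 : t < n + 1 := Nat.lt_floor_add_one t
    have h2 : (t : ℝ) < n + 1 := by exact_mod_cast h1
    have h3 : (1 : ℝ) ≤ n := by exact_mod_cast hn1
    linarith
  have hst : √(t : ℝ) ≤ 2 * √(n : ℝ) := by
    rw [Real.sqrt_le_left (by positivity), mul_pow, Real.sq_sqrt hn0.le]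
    linarith
  set ξ : ℕ → Ω → ℝ := fun i ω ↦ X ((i + 1 : ℕ) : ℝ≥0) ω - X (i : ℝ≥0) ω with hξ
  have hind : iIndepFun ξ P := hX.indepIncrements.nat Nat.mono_cast
  have hb := h x hx n hn1 ξ (hind.precomp Fin.val_injective) fun i _ ↦ by
    have := hX.stationaryIncrements i 1
    simp only [hξ, Nat.cast_succ]
    exact this
  calc P.real {ω | -x ≤ runningInf X t ω} ≤ P.real {ω | ∀ j ≤ n, -x ≤ walk ξ j ω} := by
        refine ENNReal.toReal_mono (measure_ne_top _ _) (measure_mono_ae ?_)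
        filter_upwards [hX.ae_runningInf_le, hX.zero] with ω h1 h2 h3 j hj
        have h4 := Finset.sum_range_sub (fun i : ℕ ↦ X (i : ℝ≥0) ω) j
        rw [Nat.cast_zero, h2, sub_zero] at h4
        change -x ≤ ∑ i ∈ Finset.range j, (X ((i + 1 : ℕ) : ℝ≥0) ω - X (i : ℝ≥0) ω)
        rw [h4]
        have h3' : -x ≤ runningInf X t ω := h3
        exact h3'.trans (h1 _ _ (le_trans (by exact_mod_cast hj) hnt))
    _ ≤ c * ((x + 1) / √(n : ℝ)) := hb
    _ ≤ c * ((x + 1) / (√(t : ℝ) / 2)) := by gcongr; linarith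
    _ = 2 * c * ((x + 1) / √(t : ℝ)) := by field_simp
    _ ≤ _ := by gcongr; linarith

/-- Local estimate for the endpoint of a path that stays above `-x`. -/
lemma IsLevyProcess.exists_measureReal_mem_Icc_le_runningInf_le (hX : IsLevyProcess X P)
    (hvar : ∀ t : ℝ≥0, MemLp (X t) 2 P) (hmean : ∀ t : ℝ≥0, ∫ ω, X t ω ∂P = 0)
    (hnondeg : 0 < Var[X 1; P]) {C₀ : ℝ} (hC₀ : 0 < C₀) :
    ∃ c : ℝ, 0 < c ∧ ∀ x g : ℝ, 0 ≤ x → -x ≤ g → ∀ t : ℝ≥0, 0 < t →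
      P.real {ω | g ≤ X t ω ∧ X t ω ≤ g + C₀ ∧ -x ≤ runningInf X t ω} ≤
        c * (min (x + 1) √(t : ℝ) * min (g + x + 1) √(t : ℝ) / (t : ℝ) ^ (3 / 2 : ℝ)) := by
  obtain ⟨c₁, hc₁, h₁⟩ := hX.exists_measureReal_forall_le_walk_le hvar hmean hnondeg
  obtain ⟨c₂, hc₂, h₂⟩ := hX.neg.exists_measureReal_forall_le_walk_le (fun t ↦ (hvar t).neg)
    (fun t ↦ by simp [integral_neg, hmean]) (by rwa [Pi.neg_apply, variance_neg])
  obtain ⟨q, hq, hconc⟩ := hX.exists_concentration (hvar 1) (hmean 1) hnondeg hC₀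
  -- The `3` comes from `√t ≤ 3 √n` with `n = ⌊t / 3⌋`, and `1 + C₀` from `y + 1 ≤ (1 + C₀) (g + x +
  -- 1)`, where `y = g + x + C₀`.
  set k₁ := 3 * c₁ + 1 with hk₁
  set k₂ := 3 * c₂ * (1 + C₀) + 1 with hk₂
  -- The `8` settles `t < 3`, where each of the three factors is at least `1 / 2`.
  refine ⟨2 * q * C₀ * (k₁ * k₂) + 8, by positivity, fun x g hx hg t ht ↦ ?_⟩
  have ht0 : (0 : ℝ) < t := by exact_mod_cast ht
  have hs : 0 < √(t : ℝ) := Real.sqrt_pos.2 ht0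
  have hss : √(t : ℝ) ^ 2 = t := Real.sq_sqrt ht0.le
  set s := √(t : ℝ) with hsdef
  have hgx : 1 ≤ g + x + 1 := by linarith
  have hform : min (x + 1) s * min (g + x + 1) s / (t : ℝ) ^ (3 / 2 : ℝ) =
      1 / s * (min (x + 1) s / s * (min (g + x + 1) s / s)) := by
    rw [rpow_three_halves_eq ht0.le, ← hsdef]
    field_simp
  rw [hform]
  have hm1 : 0 ≤ min (x + 1) s / s := by positivity
  have hm2 : 0 ≤ min (g + x + 1) s / s := by positivity
  rcases lt_or_ge t 3 with h3 | h3
  · have h3' : (t : ℝ) < 3 := by exact_mod_cast h3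
    have hs2 : s ≤ 2 := by
      rw [hsdef, Real.sqrt_le_left (by norm_num)]
      linarith
    have ha := half_le_min_div (a := x + 1) (by linarith) hs hs2
    have hb := half_le_min_div hgx hs hs2
    have hc : 1 / 2 ≤ 1 / s := one_div_le_one_div_of_le hs hs2
    calc _ ≤ (1 : ℝ) := measureReal_le_one
      _ = 8 * (1 / 2 * (1 / 2 * (1 / 2))) := by norm_num
      _ ≤ 8 * (1 / s * (min (x + 1) s / s * (min (g + x + 1) s / s))) := by gcongr
      _ ≤ _ := by
          gcongr
          have : 0 ≤ 2 * q * C₀ * (k₁ * k₂) := by positivity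
          linarith
  -- large times
  set n := ⌊t / 3⌋₊ with hn
  have hnt : (n : ℝ≥0) ≤ t / 3 := Nat.floor_le zero_le
  have hnt' : (n : ℝ) ≤ t / 3 := by exact_mod_cast hnt
  have hn1 : 1 ≤ n := Nat.one_le_floor_iff _ |>.2 ((one_le_div (by norm_num)).2 h3)
  have hn1' : (1 : ℝ) ≤ n := by exact_mod_cast hn1
  have hn0 : (0 : ℝ) < n := by exact_mod_cast hn1
  have htn : (t : ℝ) ≤ 9 * n := by
    have h1 : t / 3 < n + 1 := Nat.lt_floor_add_one _
    have h2 : (t : ℝ) / 3 < n + 1 := by exact_mod_cast h1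
    linarith
  have hst : s ≤ 3 * √(n : ℝ) := by
    rw [hsdef, Real.sqrt_le_left (by positivity), mul_pow, Real.sq_sqrt hn0.le]
    linarith
  have h2n : (2 * n : ℝ≥0) ≤ t := by
    rw [← NNReal.coe_le_coe]
    push_cast
    linarith
  have hnlet : (n : ℝ≥0) ≤ t := by
    rw [← NNReal.coe_le_coe]
    push_cast
    linarith
  set τ := twoSidedGrid n t with hτ
  set ζ : ℕ → Ω → ℝ := fun i ω ↦ X (τ (i + 1)) ω - X (τ i) ω with hζ
  have hind : iIndepFun ζ P := hX.indepIncrements.nat (monotone_twoSidedGrid h2n)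
  have hζm (i : ℕ) : Measurable (ζ i) := (hX.measurable _).sub (hX.measurable _)
  have hζfor (i : ℕ) (hi : i < n) : IdentDistrib (ζ i) (X 1) P P := by
    have := hX.stationaryIncrements i 1
    simp only [hζ, hτ, twoSidedGrid_of_le t hi.le, twoSidedGrid_of_le t (Nat.succ_le_of_lt hi),
      Nat.cast_succ]
    exact this
  have hζback (i : ℕ) (hi : i < n) (ω : Ω) :
      ζ (2 * n - i) ω = X (t - i) ω - X (t - (i + 1 : ℕ)) ω := by
    simp only [hζ, hτ]
    rw [← twoSidedGrid_sub t hi.le, ← twoSidedGrid_sub t (Nat.succ_le_of_lt hi),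
      show 2 * n - i + 1 = 2 * n + 1 - i by omega, show 2 * n - i = 2 * n + 1 - (i + 1) by omega]
  have hζmid (ω : Ω) : ζ n ω = X (t - n) ω - X n ω := by
    simp only [hζ, hτ]
    rw [← twoSidedGrid_sub t le_rfl, show 2 * n + 1 - n = n + 1 by omega,
      twoSidedGrid_of_le t le_rfl]
  set η : ℕ → Ω → ℝ := fun i ω ↦ -ζ (2 * n - i) ω with hη
  have hηid (i : ℕ) (hi : i < n) : IdentDistrib (η i) ((-X) 1) P P := by
    have hle : ((i + 1 : ℕ) : ℝ≥0) ≤ t := le_trans (by exact_mod_cast hi) hnlet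
    have h1 := hX.neg.stationaryIncrements (t - (i + 1 : ℕ)) 1
    have h2 : t - (i + 1 : ℕ) + 1 = t - (i : ℝ≥0) := by
      rw [← NNReal.coe_inj, NNReal.coe_add, NNReal.coe_sub hle,
        NNReal.coe_sub (le_trans (by exact_mod_cast Nat.le_succ i) hle)]
      push_cast
      ring
    rw [h2] at h1
    convert h1 using 1
    ext ω
    simp only [hη, hζback i hi, Pi.sub_apply, Pi.neg_apply]
    ring
  have hηind : iIndepFun (fun i : Fin n ↦ η i) P := by
    have h1 := hind.precomp (g := fun i : Fin n ↦ 2 * n - (i : ℕ)) fun i j hij ↦ by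
      ext
      have := i.2
      have := j.2
      simp only at hij
      omega
    exact h1.comp (fun _ ↦ Neg.neg) fun _ ↦ measurable_neg
  have hwfor (j : ℕ) (hj : j ≤ n) (ω : Ω) : walk ζ j ω = X j ω - X 0 ω := by
    have h1 := Finset.sum_range_sub (fun i : ℕ ↦ X (τ i) ω) j
    rw [hτ, twoSidedGrid_of_le t hj, twoSidedGrid_of_le t (Nat.zero_le n), Nat.cast_zero] at h1
    exact h1
  have hwback (j : ℕ) (hj : j ≤ n) (ω : Ω) : walk η j ω = X (t - j) ω - X t ω := by
    have h1 := Finset.sum_range_sub (fun i : ℕ ↦ X (t - i) ω) j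
    rw [Nat.cast_zero, tsub_zero] at h1
    rw [← h1]
    refine Finset.sum_congr rfl fun i hi ↦ ?_
    simp only [hη, hζback i ((Finset.mem_range.1 hi).trans_le hj)]
    ring
  -- From `X t ≤ g + C₀` and a path above `-x`, the reversed walk `X (t - j) - X t` stays above
  -- `-y`.
  set y := g + x + C₀ with hy
  have hy0 : 0 ≤ y := by linarith
  have hmid (r : ℝ) : P.real {ω | r ≤ ζ n ω ∧ ζ n ω ≤ r + C₀} ≤ 2 * q * C₀ * (1 / s) := by
    set u : ℝ≥0 := t - 2 * n with hu
    have hu' : (u : ℝ) = t - 2 * n := by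
      rw [hu, NNReal.coe_sub h2n]
      push_cast
      ring
    -- The middle piece lasts at least `t / 3`; the weaker `t / 4` has a clean square root, which is
    -- the source of the factor `2`.
    have hu3 : (t : ℝ) / 4 ≤ u := by linarith
    have hu0 : (0 : ℝ) < u := by linarith
    have hid : IdentDistrib (ζ n) (X u) P P := by
      have h1 := hX.stationaryIncrements n u
      have h2 : (n : ℝ≥0) + u = t - n := by
        rw [← NNReal.coe_inj, NNReal.coe_add, hu', NNReal.coe_sub hnlet]
        push_cast
        ring
      rw [h2] at h1
      convert h1 using 1
      ext ω
      exact hζmid ω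
    have h1 : P.real {ω | r ≤ ζ n ω ∧ ζ n ω ≤ r + C₀} =
        P.real {ω | r ≤ X u ω ∧ X u ω ≤ r + C₀} :=
      congrArg ENNReal.toReal (hid.measure_mem_eq (measurableSet_Icc (a := r) (b := r + C₀)))
    rw [h1]
    have hsu : s / 2 ≤ √(u : ℝ) := Real.le_sqrt_of_sq_le (by rw [div_pow, hss]; linarith)
    calc _ ≤ q * (C₀ / √(u : ℝ)) := hconc C₀ le_rfl u (by exact_mod_cast hu0) r
      _ ≤ q * (C₀ / (s / 2)) := by gcongr
      _ = _ := by field_simp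
  have hb1 : P.real {ω | ∀ j ≤ n, -x ≤ walk ζ j ω} ≤ k₁ * (min (x + 1) s / s) := by
    refine le_mul_min_div measureReal_le_one (by linarith) hs ?_
    calc _ ≤ c₁ * ((x + 1) / √(n : ℝ)) :=
          h₁ x hx n hn1 ζ (hind.precomp Fin.val_injective) hζfor
      _ ≤ c₁ * ((x + 1) / (s / 3)) := by gcongr; linarith
      _ = 3 * c₁ * ((x + 1) / s) := by field_simp
      _ ≤ _ := by gcongr; linarith
  have hb2 : P.real {ω | ∀ j ≤ n, -y ≤ walk η j ω} ≤ k₂ * (min (g + x + 1) s / s) := by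
    have hk₂1 : 1 ≤ k₂ := by
      have : 0 ≤ 3 * c₂ * (1 + C₀) := by positivity
      linarith
    refine le_mul_min_div measureReal_le_one hk₂1 hs ?_
    calc _ ≤ c₂ * ((y + 1) / √(n : ℝ)) := h₂ y hy0 n hn1 η hηind hηid
      _ ≤ c₂ * ((1 + C₀) * (g + x + 1) / (s / 3)) := by
          gcongr
          · nlinarith
          · linarith
      _ = 3 * c₂ * (1 + C₀) * ((g + x + 1) / s) := by field_simp
      _ ≤ _ := by gcongr; linarith
  calc P.real {ω | g ≤ X t ω ∧ X t ω ≤ g + C₀ ∧ -x ≤ runningInf X t ω}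
      ≤ P.real {ω | (∀ j ≤ n, -x ≤ walk ζ j ω) ∧ (∀ j ≤ n, -y ≤ walk η j ω) ∧
          g ≤ walk ζ n ω + ζ n ω - walk η n ω ∧ walk ζ n ω + ζ n ω - walk η n ω ≤ g + C₀} := by
        refine ENNReal.toReal_mono (measure_ne_top _ _) (measure_mono_ae ?_)
        filter_upwards [hX.ae_runningInf_le, hX.zero] with ω hle h0 hω
        obtain ⟨ha, hb, hc⟩ : g ≤ X t ω ∧ X t ω ≤ g + C₀ ∧ -x ≤ runningInf X t ω := hω
        have hX' : walk ζ n ω + ζ n ω - walk η n ω = X t ω := by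
          rw [hwfor n le_rfl, hwback n le_rfl, hζmid, h0]
          ring
        refine ⟨fun j hj ↦ ?_, fun j hj ↦ ?_, hX'.symm ▸ ha, hX'.symm ▸ hb⟩
        · rw [hwfor j hj, h0, sub_zero]
          exact hc.trans (hle _ _ (le_trans (by exact_mod_cast hj) hnlet))
        · rw [hwback j hj]
          have := hc.trans (hle (t - j) t tsub_le_self)
          linarith
    _ ≤ 2 * q * C₀ * (1 / s) * (P.real {ω | ∀ j ≤ n, -x ≤ walk ζ j ω} *
          P.real {ω | ∀ j ≤ n, -y ≤ walk η j ω}) :=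
        measureReal_three_parts_le hind hζm n hmid x y g
    _ ≤ 2 * q * C₀ * (1 / s) * (k₁ * (min (x + 1) s / s) * (k₂ * (min (g + x + 1) s / s))) := by
        gcongr
    _ = 2 * q * C₀ * (k₁ * k₂) * (1 / s * (min (x + 1) s / s * (min (g + x + 1) s / s))) := by ring
    _ ≤ _ := by gcongr; linarith

/-- Global estimate for the endpoint of a path that stays above `-x`. -/
lemma IsLevyProcess.exists_measureReal_le_le_runningInf_le (hX : IsLevyProcess X P)
    (hvar : ∀ t : ℝ≥0, MemLp (X t) 2 P) (hmean : ∀ t : ℝ≥0, ∫ ω, X t ω ∂P = 0)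
    (hnondeg : 0 < Var[X 1; P]) :
    ∃ c : ℝ, 0 < c ∧ ∀ x g : ℝ, 0 ≤ x → -x ≤ g → ∀ t : ℝ≥0, 0 < t →
      P.real {ω | X t ω ≤ g ∧ -x ≤ runningInf X t ω} ≤
        c * (min (x + 1) √(t : ℝ) * min ((g + x + 1) ^ 2) (t : ℝ) / (t : ℝ) ^ (3 / 2 : ℝ)) := by
  obtain ⟨c₁, hc₁, h₁⟩ := hX.exists_measureReal_le_runningInf_le hvar hmean hnondeg
  obtain ⟨c₂, hc₂, h₂⟩ := hX.exists_measureReal_mem_Icc_le_runningInf_le hvar hmean hnondeg one_pos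
  refine ⟨c₁ + c₂, by positivity, fun x g hx hg t ht ↦ ?_⟩
  have ht0 : (0 : ℝ) < t := by exact_mod_cast ht
  have hs : 0 < √(t : ℝ) := Real.sqrt_pos.2 ht0
  have hss : √(t : ℝ) ^ 2 = t := Real.sq_sqrt ht0.le
  have hrpow := rpow_three_halves_eq ht0.le
  set s := √(t : ℝ) with hsdef
  set p := P.real {ω | X t ω ≤ g ∧ -x ≤ runningInf X t ω} with hp
  have hm : 0 < min (x + 1) s := lt_min (by linarith) hs
  have hgx : 0 ≤ g + x := by linarith
  have hbig : p ≤ c₁ * (min (x + 1) s * t / (t : ℝ) ^ (3 / 2 : ℝ)) := by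
    calc p ≤ P.real {ω | -x ≤ runningInf X t ω} := measureReal_mono fun ω hω ↦ hω.2
      _ ≤ c₁ * (min (x + 1) s / s) := h₁ x hx t ht
      _ = _ := by
          rw [hrpow, ← hss]
          field_simp
  have hsmall : p ≤ c₂ * (min (x + 1) s * (g + x + 1) ^ 2 / (t : ℝ) ^ (3 / 2 : ℝ)) := by
    -- Unit windows starting at `-x` cover `[-x, g]`. The `k`-th contributes the factor `k + 1 ≤ g +
    -- x + 1`, and there are at most `g + x + 1` of them, hence the square.
    set N := ⌊g + x⌋₊ + 1 with hN
    have hNle : (N : ℝ) ≤ g + x + 1 := by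
      rw [hN]
      push_cast
      linarith [Nat.floor_le hgx]
    calc p ≤ P.real (⋃ k ∈ Finset.range N, {ω | -x + k ≤ X t ω ∧ X t ω ≤ -x + k + 1 ∧
            -x ≤ runningInf X t ω}) := by
          refine ENNReal.toReal_mono (measure_ne_top _ _) (measure_mono_ae ?_)
          filter_upwards [hX.ae_runningInf_le] with ω hle hω
          obtain ⟨ha, hb⟩ : X t ω ≤ g ∧ -x ≤ runningInf X t ω := hω
          have h0 : 0 ≤ X t ω + x := by linarith [hle t t le_rfl]
          change ω ∈ ⋃ k ∈ Finset.range N, {ω | -x + k ≤ X t ω ∧ X t ω ≤ -x + k + 1 ∧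
            -x ≤ runningInf X t ω}
          simp only [Set.mem_iUnion, Finset.mem_range, Set.mem_ofPred_eq, exists_prop]
          refine ⟨⌊X t ω + x⌋₊, Nat.lt_succ_of_le (Nat.floor_le_floor (by linarith)), ?_, ?_, hb⟩
          · linarith [Nat.floor_le h0]
          · linarith [Nat.lt_floor_add_one (X t ω + x)]
      _ ≤ ∑ k ∈ Finset.range N, P.real {ω | -x + k ≤ X t ω ∧ X t ω ≤ -x + k + 1 ∧
            -x ≤ runningInf X t ω} := measureReal_biUnion_finset_le _ _
      _ ≤ ∑ _k ∈ Finset.range N,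
            c₂ * (min (x + 1) s * (g + x + 1) / (t : ℝ) ^ (3 / 2 : ℝ)) := by
          refine Finset.sum_le_sum fun k hk ↦ (h₂ x (-x + k) hx (by simp) t ht).trans ?_
          gcongr
          refine (min_le_left _ _).trans ?_
          have h1 : (k : ℝ) + 1 ≤ N := by exact_mod_cast Finset.mem_range.1 hk
          linarith
      _ = N * (c₂ * (min (x + 1) s * (g + x + 1) / (t : ℝ) ^ (3 / 2 : ℝ))) := by simp
      _ ≤ (g + x + 1) * (c₂ * (min (x + 1) s * (g + x + 1) / (t : ℝ) ^ (3 / 2 : ℝ))) := by gcongr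
      _ = _ := by ring
  rcases le_total ((g + x + 1) ^ 2) (t : ℝ) with h | h
  · rw [min_eq_left h]
    refine hsmall.trans ?_
    gcongr
    linarith
  · rw [min_eq_right h]
    refine hbig.trans ?_
    gcongr
    linarith

end Main

theorem mainTheorem5 {Ω : Type*} [MeasurableSpace Ω] (P : Measure Ω) [IsProbabilityMeasure P]
    (X : ℝ≥0 → Ω → ℝ) (hX : IsLevyProcess X P)
    (hvar : ∀ t : ℝ≥0, MemLp (X t) 2 P)
    (hmean : ∀ t : ℝ≥0, ∫ ω, X t ω ∂P = 0)
    (hnondeg : 0 < Var[X 1; P]) :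
    (∀ C₀ : ℝ, 0 < C₀ →
      (∃ c : ℝ, 0 < c ∧ ∀ h : ℝ, C₀ ≤ h → ∀ t : ℝ≥0, 0 < t → ∀ r : ℝ,
        P.real {ω | r ≤ X t ω ∧ X t ω ≤ r + h} ≤ c * (h / √(t : ℝ))) ∧
      (∃ c : ℝ, 0 < c ∧ ∀ (f : ℝ≥0 → ℝ≥0) (g : ℝ≥0 → ℝ),
        (∃ ε : ℝ≥0, 0 < ε ∧ ∀ t, ε ≤ f t) → (∀ t, -(f t : ℝ) ≤ g t) →
        ∀ t : ℝ≥0, 0 < t →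
          P.real {ω | g t ≤ X t ω ∧ X t ω ≤ g t + C₀ ∧ -(f t : ℝ) ≤ runningInf X t ω} ≤
            c * (min ((f t : ℝ) + 1) √(t : ℝ) * min (g t + (f t : ℝ) + 1) √(t : ℝ) /
              (t : ℝ) ^ (3 / 2 : ℝ)))) ∧
    (∃ c' : ℝ, 0 < c' ∧ ∀ (f : ℝ≥0 → ℝ≥0) (g : ℝ≥0 → ℝ),
      (∃ ε : ℝ≥0, 0 < ε ∧ ∀ t, ε ≤ f t) → (∀ t, -(f t : ℝ) ≤ g t) →
      ∀ t : ℝ≥0, 0 < t →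
        P.real {ω | X t ω ≤ g t ∧ -(f t : ℝ) ≤ runningInf X t ω} ≤
          c' * (min ((f t : ℝ) + 1) √(t : ℝ) * min ((g t + (f t : ℝ) + 1) ^ 2) (t : ℝ) /
            (t : ℝ) ^ (3 / 2 : ℝ))) := by
  refine ⟨fun C₀ hC₀ ↦ ⟨hX.exists_concentration (hvar 1) (hmean 1) hnondeg hC₀, ?_⟩, ?_⟩
  · obtain ⟨c, hc, h⟩ :=
      hX.exists_measureReal_mem_Icc_le_runningInf_le hvar hmean hnondeg hC₀
    exact ⟨c, hc, fun f g _ hg t ht ↦ h (f t) (g t) (f t).2 (hg t) t ht⟩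
  · obtain ⟨c, hc, h⟩ := hX.exists_measureReal_le_le_runningInf_le hvar hmean hnondeg
    exact ⟨c, hc, fun f g _ hg t ht ↦ h (f t) (g t) (f t).2 (hg t) t ht⟩
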